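/- **Theorem 2.1.** Let $2\le p<\infty$ and let $q\in(2,\infty]$ be defined by $\frac1p+\frac1q=\frac12$. Let $L^s$, $1\le s\le\infty$, be the spaces of complex functions on the unit circle $\mathbb T$ with respect to normalized Lebesgue measure, and let $H^s\subset L^s$ be the Hardy class of functions whose Fourier coefficients of negative index vanish, identified as usual with functions analytic in the unit disk $\mathbb D$. A function $\varphi\in L^p$ is called $p$-badly approximable if $\|\varphi-\psi\|_{L^p}\ge\|\varphi\|_{L^p}$ for every $\psi\in H^p$. An inner function is a function $\vartheta\in H^\infty$ with $|\vartheta|=1$ almost everywhere on $\mathbb T$. A function $h\in H^2$ is called outer if the set $\{hf: f \text{ an analytic polynomial}\}$ is dense in $H^2$. Let $\varphi$ be a nonzero function in $L^p$. Then $\varphi$ is $p$-badly approximable if and only if there exist an inner function $\vartheta$ and an outer function $h$ in $H^2$ such that $$\varphi=\bar z\,\bar\vartheta\,\frac{\bar h}{h^{2/q}}=\bar z\,\bar\vartheta\,\frac{\bar h}{h^{(p-2)/p}}$$ almost everywhere on $\mathbb T$. Here $2/q=0$ if $p=2$, and $h^{2/q}$ is the boundary function of $\exp\left(\frac2q\log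 h\right)$ for some analytic branch of $\log h$ in $\mathbb D$. -/

import Mathlib

open MeasureTheory
open scoped ENNReal ComplexConjugate

/-!
Functions on the unit circle are functions of the angle `t : AddCircle (2 * π)`; the point of the
unit circle with angle `t` is `zeta t`, and the measure is normalized Lebesgue measure. As usual,
functions that agree almost everywhere are not distinguished.
-/

namespace HardyApprox

/-- The parameter space of the unit circle, by the angle modulo `2π`. -/
abbrev Torus : Type := AddCircle (2 * Real.pi)

instance instFactTwoPiPos : Fact (0 < 2 * Real.pi) := ⟨Real.two_pi_pos⟩

/-- Normalized Lebesgue measure on the unit circle. -/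
noncomputable abbrev m : Measure Torus := AddCircle.haarAddCircle

/-- The coordinate function `z` on the unit circle. -/
noncomputable def zeta (t : Torus) : ℂ := (AddCircle.toCircle t : ℂ)

/-- Membership in the Hardy class `H^s` on the unit circle, `1 ≤ s ≤ ∞`: functions in `L^s` whose
Fourier coefficients of negative index vanish. -/
def MemHardy (f : Torus → ℂ) (s : ℝ≥0∞) : Prop :=
  MemLp f s m ∧ ∀ n : ℤ, n < 0 → fourierCoeff f n = 0

/-- The analytic function in the open unit disk that corresponds to `f` of Hardy class. -/
noncomputable def extension (f : Torus → ℂ) (w : ℂ) : ℂ :=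
  ∑' n : ℕ, fourierCoeff f (n : ℤ) * w ^ n

/-- Inner functions: functions in `H^∞` that are unimodular almost everywhere on the circle. -/
def IsInner (θ : Torus → ℂ) : Prop :=
  MemHardy θ ∞ ∧ ∀ᵐ t ∂m, ‖θ t‖ = 1

/-- Outer functions of class `H²`: the multiples of `h` by analytic polynomials are
dense in `H²`. -/
def IsOuter (h : Torus → ℂ) : Prop :=
  MemHardy h 2 ∧
    ∀ g : Torus → ℂ, MemHardy g 2 → ∀ ε : ℝ, 0 < ε →
      ∃ P : Polynomial ℂ, eLpNorm (fun t => g t - P.eval (zeta t) * h t) 2 m < ENNReal.ofReal ε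

/-- `k` is (the boundary function of) a power `h ^ α`: `k` is of class `H¹`, and in the disk it is
`exp (α log h)` for some analytic branch of `log h` there. This is not a pointwise power of the
boundary values of `h` with the principal branch. Different branches give the same `k` up to a
unimodular constant factor. -/
def IsAnalyticPower (h : Torus → ℂ) (α : ℝ) (k : Torus → ℂ) : Prop :=
  MemHardy k 1 ∧
    ∃ L : ℂ → ℂ, DifferentiableOn ℂ L (Metric.ball 0 1) ∧
      ∀ w ∈ Metric.ball (0 : ℂ) 1,
        Complex.exp (L w) = extension h w ∧ extension k w = Complex.exp ((α : ℂ) * L w)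

/-- A function `φ` of class `L^p` is `p`-badly approximable if no function in `H^p` approximates it
better in the norm of `L^p` than the zero function. -/
def IsBadlyApproximable (p : ℝ≥0∞) (φ : Torus → ℂ) : Prop :=
  MemLp φ p m ∧
    ∀ ψ : Torus → ℂ, MemHardy ψ p → eLpNorm φ p m ≤ eLpNorm (fun t => φ t - ψ t) p m

end HardyApprox

namespace HardyApprox

open Filter Topology

/-! Everything passes through the dual function g = |φ|^(p-2) conj φ. The p-th power of the L^p norm
is convex, and its derivative at φ in the direction -ψ is -p Re ∫ gψ. Hence φ is badly approximable
exactly when g annihilates H^p. Sufficiency is the integrated tangent line inequality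
(`isBadlyApproximable_of_integral_eq_zero`). Necessity is criticality tested on monomials, which
kills the Fourier coefficients of g of index ≤ 0
(`IsBadlyApproximable.fourierCoeff_dualFunction_eq_zero`).

If φ has the stated form and k = h^(2/q), then |φ| = |h|^(2/p) and g = z h θ k
(`dualFunction_ae_eq`). For ψ in H^p, Hölder's inequality puts kψ in L², so gψ is z times the
product of the H² functions h and θkψ, and its integral is zero.

Conversely, let g have no coefficients of index ≤ 0. Since g is nonzero, it has a first nonzero
coefficient, and the projection proof of Szegő's theorem (`exists_isOuter_norm_eq`) then yields an
outer h with |h| = |φ|^(p/2). The formula to be proved determines a unimodular θ, for which g = z h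
θ k. That θ is analytic follows by cancelling outer factors (`IsOuter.fourierCoeff_eq_zero_of_mul`):
first h from θkh, which leaves θk in H²; then, after multiplication by the complementary power k'
with kk' = h, again h from θh. No inner-outer factorization in H¹ is needed.

The powers h^α, 0 ≤ α ≤ 1, are built in the disk from a logarithm of the extension. The bound |h|^α
≤ 1 + |h| gives square summable Taylor coefficients, and limits along a common sequence of radii
carry identities from the disk to the circle. -/

/-! ### Characters, the L² pairing and Fourier coefficients on the circle. -/

lemma zeta_pow (n : ℕ) (t : Torus) : zeta t ^ n = fourier (n : ℤ) t := by
  simp [zeta, AddCircle.toCircle_nsmul]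

lemma zeta_eq_fourier (t : Torus) : zeta t = fourier 1 t := by
  simp [zeta]

lemma norm_zeta (t : Torus) : ‖zeta t‖ = 1 :=
  Circle.norm_coe _

lemma norm_fourier_apply (n : ℤ) (t : Torus) : ‖fourier n t‖ = 1 :=
  Circle.norm_coe _

lemma aestronglyMeasurable_fourier (n : ℤ) : AEStronglyMeasurable (fun t => fourier n t) m :=
  (map_continuous (fourier n)).aestronglyMeasurable

lemma continuous_zeta : Continuous zeta := by
  have : zeta = fun t => fourier 1 t := funext zeta_eq_fourier
  rw [this]; exact map_continuous _

lemma continuous_eval_zeta (P : Polynomial ℂ) : Continuous fun t => P.eval (zeta t) :=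
  P.continuous.comp continuous_zeta

lemma memLp_of_continuous {f : Torus → ℂ} (hf : Continuous f) (s : ℝ≥0∞) : MemLp f s m := by
  obtain ⟨C, hC⟩ := (isCompact_range hf).isBounded.exists_norm_le
  exact MemLp.of_bound hf.aestronglyMeasurable C (Eventually.of_forall fun t => hC _ ⟨t, rfl⟩)

/-- Multiplication by a continuous function preserves the `L^s` classes. -/
lemma memLp_continuous_mul {f g : Torus → ℂ} {s : ℝ≥0∞} (hg : Continuous g) (hf : MemLp f s m) :
    MemLp (fun t => g t * f t) s m := by
  obtain ⟨C, hC⟩ := (isCompact_range hg).isBounded.exists_norm_le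
  refine hf.of_le_mul (c := C) (hg.aestronglyMeasurable.mul hf.1) (Eventually.of_forall fun t => ?_)
  rw [norm_mul]
  exact mul_le_mul_of_nonneg_right (hC _ ⟨t, rfl⟩) (norm_nonneg _)

lemma memLp_fourier_mul {f : Torus → ℂ} {s : ℝ≥0∞} (n : ℤ) (hf : MemLp f s m) :
    MemLp (fun t => fourier n t * f t) s m :=
  memLp_continuous_mul (map_continuous (fourier n)) hf

lemma memLp_conj {f : Torus → ℂ} {s : ℝ≥0∞} (hf : MemLp f s m) :
    MemLp (fun t => conj (f t)) s m :=
  hf.star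

lemma integrable_mul_of_memLp_two {f g : Torus → ℂ} (hf : MemLp f 2 m) (hg : MemLp g 2 m) :
    Integrable (fun t => f t * g t) m :=
  hf.integrable_mul hg

lemma integrable_of_memLp_two {f : Torus → ℂ} (hf : MemLp f 2 m) : Integrable f m :=
  hf.integrable (by norm_num)

lemma inner_toLp_conj {f g : Torus → ℂ} (hf : MemLp f 2 m) (hg : MemLp g 2 m) :
    inner ℂ ((memLp_conj hf).toLp _) (hg.toLp g) = ∫ t, f t * g t ∂m := by
  rw [L2.inner_def]
  refine integral_congr_ae ?_
  filter_upwards [(memLp_conj hf).coeFn_toLp, hg.coeFn_toLp] with t h1 h2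
  rw [h1, h2, RCLike.inner_apply, Complex.conj_conj, mul_comm]

/-- The Cauchy–Schwarz inequality. -/
lemma norm_integral_mul_le {f g : Torus → ℂ} (hf : MemLp f 2 m) (hg : MemLp g 2 m) :
    ‖∫ t, f t * g t ∂m‖ ≤ (eLpNorm f 2 m).toReal * (eLpNorm g 2 m).toReal := by
  rw [← inner_toLp_conj hf hg]
  refine (norm_inner_le_norm _ _).trans (le_of_eq ?_)
  rw [Lp.norm_toLp, Lp.norm_toLp]
  congr 2
  exact eLpNorm_congr_norm_ae (Eventually.of_forall fun t => by simp)

lemma fourierCoeff_fourier_mul (f : Torus → ℂ) (j n : ℤ) :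
    fourierCoeff (fun t => fourier j t * f t) n = fourierCoeff f (n - j) := by
  unfold fourierCoeff
  refine integral_congr_ae (Eventually.of_forall fun t => ?_)
  simp only [smul_eq_mul]
  rw [← mul_assoc, ← fourier_add]
  congr 3; ring

lemma integral_fourier_mul (f : Torus → ℂ) (n : ℤ) :
    ∫ t, fourier n t * f t ∂m = fourierCoeff f (-n) := by
  simp [fourierCoeff]

lemma fourierCoeff_sub {f g : Torus → ℂ} (hf : Integrable f m) (hg : Integrable g m) (n : ℤ) :
    fourierCoeff (fun t => f t - g t) n = fourierCoeff f n - fourierCoeff g n := by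
  unfold fourierCoeff
  rw [← integral_sub (hf.fourier_smul _) (hg.fourier_smul _)]
  simp only [smul_sub]

lemma fourierCoeff_eval_zeta_mul {f : Torus → ℂ} (hf : Integrable f m) (P : Polynomial ℂ) (n : ℤ) :
    fourierCoeff (fun t => P.eval (zeta t) * f t) n =
      ∑ i ∈ Finset.range (P.natDegree + 1), P.coeff i * fourierCoeff f (n - i) := by
  have : (fun t => P.eval (zeta t) * f t) = ∑ i ∈ Finset.range (P.natDegree + 1),
      fun t => P.coeff i * (fourier (i : ℤ) t * f t) := by
    ext t
    rw [Polynomial.eval_eq_sum_range, Finset.sum_mul, Finset.sum_apply]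
    exact Finset.sum_congr rfl fun i _ => by rw [zeta_pow, mul_assoc]
  rw [this, fourierCoeff.sum _ _ fun i _ => by exact (hf.fourier_smul (i : ℤ)).const_mul (P.coeff i), Finset.sum_apply]
  exact Finset.sum_congr rfl fun i _ => by rw [fourierCoeff.const_mul, fourierCoeff_fourier_mul]

/-! ### Uniqueness of Fourier coefficients, Parseval and Riesz–Fischer. -/

/-- An integrable function on the circle with vanishing Fourier coefficients is zero. -/
theorem ae_eq_zero_of_fourierCoeff_eq_zero {f : Torus → ℂ} (hf : Integrable f m)
    (h : ∀ n, fourierCoeff f n = 0) : f =ᵐ[m] 0 := by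
  -- Pairing with f is a bounded functional on continuous functions; it vanishes on the characters,
  -- whose span is dense.
  have key : ∀ g : C(Torus, ℂ), ∫ t, g t * f t ∂m = 0 := by
    intro g
    have hint : ∀ g : C(Torus, ℂ), Integrable (fun t => g t * f t) m := fun g =>
      memLp_one_iff_integrable.1 (memLp_continuous_mul (map_continuous g)
        (memLp_one_iff_integrable.2 hf))
    let ℓ : C(Torus, ℂ) →L[ℂ] ℂ := LinearMap.mkContinuous
      { toFun := fun g => ∫ t, g t * f t ∂m
        map_add' := fun a b => by
          rw [← integral_add (hint a) (hint b)]; simp [add_mul]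
        map_smul' := fun c a => by
          simp [mul_assoc, integral_const_mul] } (∫ t, ‖f t‖ ∂m) fun a => by
        simp only [LinearMap.coe_mk, AddHom.coe_mk]
        refine (norm_integral_le_integral_norm _).trans ?_
        rw [mul_comm (∫ t, ‖f t‖ ∂m), ← integral_const_mul]
        refine integral_mono (hint a).norm (hf.norm.const_mul _) fun t => ?_
        simp only [norm_mul]
        exact mul_le_mul_of_nonneg_right (a.norm_coe_le_norm t) (norm_nonneg _)
    have hmem : g ∈ (Submodule.span ℂ (Set.range (fourier (T := 2 * Real.pi)))).topologicalClosure := by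
      rw [span_fourier_closure_eq_top]; trivial
    have hle : (Submodule.span ℂ (Set.range (fourier (T := 2 * Real.pi)))).topologicalClosure
        ≤ LinearMap.ker (ℓ : C(Torus, ℂ) →ₗ[ℂ] ℂ) := by
      refine Submodule.topologicalClosure_minimal _ ?_ ℓ.isClosed_ker
      rw [Submodule.span_le]
      rintro _ ⟨n, rfl⟩
      change ∫ t, fourier n t * f t ∂m = 0
      rw [integral_fourier_mul, h]
    exact hle hmem
  -- Indicators of closed sets are pointwise limits of continuous functions with values in [0, 1],
  -- so f has integral zero over every closed set.
  refine ae_eq_zero_of_forall_setIntegral_isClosed_eq_zero hf fun s hs => ?_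
  have hpos : ∀ n : ℕ, (0 : ℝ) < 1 / ((n : ℝ) + 1) := fun n => Nat.one_div_pos_of_nat
  let G : ℕ → Torus → ℂ := fun n t => ((thickenedIndicator (hpos n) s t : ℝ) : ℂ)
  have hGc : ∀ n, Continuous (G n) := fun n => by
    have := (thickenedIndicator (hpos n) s).continuous
    fun_prop
  have hlim := tendsto_integral_of_dominated_convergence (μ := m)
    (F := fun n t => G n t * f t) (f := s.indicator f) (fun t => ‖f t‖)
    (fun n => (hGc n).aestronglyMeasurable.mul hf.1) hf.norm
    (fun n => Eventually.of_forall fun t => by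
      rw [norm_mul]
      refine mul_le_of_le_one_left (norm_nonneg _) ?_
      simp only [G, Complex.norm_real, NNReal.norm_eq]
      exact_mod_cast thickenedIndicator_le_one (hpos n) s t)
    (Eventually.of_forall fun t => by
      have h1 := tendsto_pi_nhds.1 (thickenedIndicator_tendsto_indicator_closure hpos
        tendsto_one_div_add_atTop_nhds_zero_nat s) t
      have h2 : Tendsto (fun n => G n t) atTop
          (𝓝 ((((closure s).indicator (fun _ => (1 : NNReal)) t : NNReal) : ℝ) : ℂ)) :=
        ((Complex.continuous_ofReal.comp NNReal.continuous_coe).tendsto _).comp h1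
      have h3 := h2.mul_const (f t)
      rw [hs.closure_eq] at h3
      convert h3 using 2
      by_cases ht : t ∈ s <;> simp [ht])
  have h0 : ∀ n, ∫ t, G n t * f t ∂m = 0 := fun n => key ⟨G n, hGc n⟩
  simp only [h0] at hlim
  rw [← integral_indicator hs.measurableSet]
  exact (tendsto_nhds_unique hlim tendsto_const_nhds)

theorem ae_eq_of_fourierCoeff_eq {f g : Torus → ℂ} (hf : Integrable f m) (hg : Integrable g m)
    (h : ∀ n, fourierCoeff f n = fourierCoeff g n) : f =ᵐ[m] g := by
  have := ae_eq_zero_of_fourierCoeff_eq_zero (hf.sub hg) fun n => by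
    have := fourierCoeff_sub hf hg n
    rw [h n, sub_self] at this
    exact this
  filter_upwards [this] with t ht
  exact sub_eq_zero.1 ht

/-- Parseval's identity in bilinear form. -/
theorem hasSum_fourierCoeff_mul {f g : Torus → ℂ} (hf : MemLp f 2 m) (hg : MemLp g 2 m) :
    HasSum (fun i : ℤ => fourierCoeff f (-i) * fourierCoeff g i) (∫ t, f t * g t ∂m) := by
  rw [← inner_toLp_conj hf hg]
  have h := fourierBasis.hasSum_inner_mul_inner ((memLp_conj hf).toLp _) (hg.toLp g)
  refine h.congr_fun fun i => ?_
  rw [← fourierBasis.repr_apply_apply, fourierBasis_repr, fourierCoeff_congr_ae hg.coeFn_toLp]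
  congr 1
  have h1 : MemLp (fun t => fourier i t) 2 m := memLp_of_continuous (map_continuous _) 2
  have h2 : (fourierBasis i : Lp ℂ 2 m) = h1.toLp _ := by
    rw [coe_fourierBasis]; rfl
  rw [h2, inner_toLp_conj hf h1]
  simp [fourierCoeff, mul_comm]

/-- The product of two functions of class `H²` has no Fourier coefficients of negative index. -/
theorem fourierCoeff_mul_eq_zero {f g : Torus → ℂ} (hf : MemHardy f 2) (hg : MemHardy g 2)
    {n : ℤ} (hn : n < 0) : fourierCoeff (fun t => f t * g t) n = 0 := by
  have h1 := hasSum_fourierCoeff_mul (memLp_fourier_mul (-n) hf.1) hg.1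
  have h2 : fourierCoeff (fun t => f t * g t) n = ∫ t, fourier (-n) t * f t * g t ∂m := by
    simp only [fourierCoeff, smul_eq_mul, mul_assoc]
  rw [h2]
  refine h1.unique ?_
  convert! hasSum_zero using 2 with i
  rw [fourierCoeff_fourier_mul]
  -- The i-th term pairs the coefficient of f at n - i with that of g at i. The two indices add up
  -- to n < 0, so one of them is negative.
  rcases lt_or_ge i 0 with hi | hi
  · rw [hg.2 i hi, mul_zero]
  · rw [hf.2 _ (by omega), zero_mul]

/-- The Riesz–Fischer theorem. -/
theorem exists_memLp_two_fourierCoeff {c : ℤ → ℂ} (hc : Summable fun n => ‖c n‖ ^ 2) :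
    ∃ f : Torus → ℂ, MemLp f 2 m ∧ ∀ n, fourierCoeff f n = c n := by
  have hc' : Memℓp c 2 := by
    rw [memℓp_gen_iff (by norm_num)]
    simpa using hc
  refine ⟨(fourierBasis.repr.symm ⟨c, hc'⟩ : Lp ℂ 2 m), Lp.memLp _, fun n => ?_⟩
  rw [← fourierBasis_repr, LinearIsometryEquiv.apply_symm_apply]

theorem hasSum_sq_norm_fourierCoeff {f : Torus → ℂ} (hf : MemLp f 2 m) :
    HasSum (fun i => ‖fourierCoeff f i‖ ^ 2) ((eLpNorm f 2 m).toReal ^ 2) := by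
  have h := hasSum_sq_fourierCoeff (hf.toLp f)
  rw [fourierCoeff_congr_ae hf.coeFn_toLp] at h
  convert h
  rw [← Lp.norm_toLp f hf, ← RCLike.ofReal_inj (K := ℂ), RCLike.ofReal_pow, ← inner_self_eq_norm_sq_to_K (𝕜 := ℂ),
    L2.inner_def, ← integral_ofReal]
  refine integral_congr_ae (Eventually.of_forall fun t => ?_)
  simp

/-! ### Polynomial approximation and outer functions. -/

lemma memLp_eval_zeta (P : Polynomial ℂ) (s : ℝ≥0∞) : MemLp (fun t => P.eval (zeta t)) s m :=
  memLp_of_continuous (continuous_eval_zeta P) s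

lemma memLp_eval_zeta_mul {f : Torus → ℂ} {s : ℝ≥0∞} (P : Polynomial ℂ) (hf : MemLp f s m) :
    MemLp (fun t => P.eval (zeta t) * f t) s m :=
  memLp_continuous_mul (continuous_eval_zeta P) hf

lemma fourierCoeff_eval_zeta_mul_eq_zero {f : Torus → ℂ} (hf : Integrable f m)
    (h : ∀ n : ℤ, n < 0 → fourierCoeff f n = 0) (P : Polynomial ℂ) {n : ℤ} (hn : n < 0) :
    fourierCoeff (fun t => P.eval (zeta t) * f t) n = 0 := by
  rw [fourierCoeff_eval_zeta_mul hf]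
  exact Finset.sum_eq_zero fun i _ => by rw [h _ (by omega), mul_zero]

lemma memHardy_one : MemHardy (fun _ => 1) 2 := by
  refine ⟨memLp_const 1, fun n hn => ?_⟩
  have h : (fun _ : Torus => (1 : ℂ)) = fourier 0 := by
    ext t; simp
  rw [h, fourierCoeff_fourier, Pi.single_eq_of_ne hn.ne]

/-- The analytic polynomials are dense in `H²`. -/
theorem exists_polynomial_eLpNorm_sub_lt {g : Torus → ℂ} (hg : MemHardy g 2) {ε : ℝ} (hε : 0 < ε) :
    ∃ Q : Polynomial ℂ, eLpNorm (fun t => g t - Q.eval (zeta t)) 2 m < ENNReal.ofReal ε := by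
  have h1 := hasSum_fourier_series_L2 (hg.1.toLp g)
  rw [fourierCoeff_congr_ae hg.1.coeFn_toLp] at h1
  have h2 : HasSum (fun n : ℕ => fourierCoeff g (n : ℤ) • fourierLp 2 (n : ℤ)) (hg.1.toLp g) := by
    refine (Function.Injective.hasSum_iff (g := fun n : ℕ => (n : ℤ)) Nat.cast_injective ?_).2 h1
    intro n hn
    have : n < 0 := by
      by_contra hc
      exact hn ⟨n.toNat, by simp; omega⟩
    rw [hg.2 n this, zero_smul]
  obtain ⟨N, hN⟩ := ((Metric.tendsto_nhds.1 h2.tendsto_sum_nat) ε hε).exists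
  let Q : Polynomial ℂ := ∑ i ∈ Finset.range N, Polynomial.monomial i (fourierCoeff g (i : ℤ))
  refine ⟨Q, ?_⟩
  have h3 : ∑ i ∈ Finset.range N, fourierCoeff g (i : ℤ) • fourierLp 2 (i : ℤ)
      = (memLp_eval_zeta Q 2).toLp _ := by
    simp only [fourierLp, ← map_smul, ← map_sum]
    refine Lp.ext ?_
    filter_upwards [(memLp_eval_zeta Q 2).coeFn_toLp, ContinuousMap.coeFn_toLp (p := 2) (𝕜 := ℂ) m
      (∑ i ∈ Finset.range N, fourierCoeff g (i : ℤ) • fourier (T := 2 * Real.pi) (i : ℤ))] with t ha hb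
    rw [ha, hb]
    simp only [Q, Polynomial.eval_finsetSum, Polynomial.eval_monomial, zeta_pow,
      ContinuousMap.coe_sum, Finset.sum_apply, ContinuousMap.coe_smul, Pi.smul_apply, smul_eq_mul]
  rw [h3, dist_comm, dist_eq_norm, ← MemLp.toLp_sub, Lp.norm_toLp] at hN
  exact (ENNReal.lt_ofReal_iff_toReal_lt (hg.1.sub (memLp_eval_zeta Q 2)).2.ne).2 hN

/-- Approximating the constant 1 suffices: g is close to a polynomial Q, and Q is bounded on the
circle, so Q(1 - Ph) is small when 1 - Ph is. -/
theorem isOuter_of_forall_approx_one {h : Torus → ℂ} (hh : MemHardy h 2)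
    (happ : ∀ ε : ℝ, 0 < ε → ∃ P : Polynomial ℂ,
      eLpNorm (fun t => 1 - P.eval (zeta t) * h t) 2 m < ENNReal.ofReal ε) : IsOuter h := by
  refine ⟨hh, fun g hg ε hε => ?_⟩
  obtain ⟨Q, hQ⟩ := exists_polynomial_eLpNorm_sub_lt hg (half_pos hε)
  obtain ⟨C, hC⟩ := (isCompact_range (continuous_eval_zeta Q)).isBounded.exists_norm_le
  have hC' : ∀ t, ‖Q.eval (zeta t)‖ ≤ |C| + 1 := fun t =>
    (hC _ ⟨t, rfl⟩).trans (by linarith [le_abs_self C])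
  have hCpos : 0 < |C| + 1 := by positivity
  obtain ⟨P, hP⟩ := happ (ε / 2 / (|C| + 1)) (by positivity)
  refine ⟨Q * P, ?_⟩
  have h1 : MemLp (fun t => g t - Q.eval (zeta t)) 2 m := hg.1.sub (memLp_eval_zeta Q 2)
  have h2 : MemLp (fun t => 1 - P.eval (zeta t) * h t) 2 m :=
    (memLp_const 1).sub (memLp_eval_zeta_mul P hh.1)
  have h3 := memLp_eval_zeta_mul Q h2
  have heq : (fun t => g t - (Q * P).eval (zeta t) * h t) =
      (fun t => g t - Q.eval (zeta t)) +
        fun t => Q.eval (zeta t) * (1 - P.eval (zeta t) * h t) := by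
    ext t; simp only [Polynomial.eval_mul, Pi.add_apply]; ring
  rw [heq]
  refine (eLpNorm_add_le h1.1 h3.1 (by norm_num)).trans_lt ?_
  have h4 : eLpNorm (fun t => Q.eval (zeta t) * (1 - P.eval (zeta t) * h t)) 2 m
      ≤ ENNReal.ofReal (|C| + 1) * eLpNorm (fun t => 1 - P.eval (zeta t) * h t) 2 m := by
    refine eLpNorm_le_mul_eLpNorm_of_ae_le_mul (Eventually.of_forall fun t => ?_) 2
    rw [norm_mul]
    exact mul_le_mul_of_nonneg_right (hC' t) (norm_nonneg _)
  calc _ ≤ eLpNorm (fun t => g t - Q.eval (zeta t)) 2 m + ENNReal.ofReal (|C| + 1) *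
        ENNReal.ofReal (ε / 2 / (|C| + 1)) := by gcongr; exact h4.trans (by gcongr)
    _ < ENNReal.ofReal (ε / 2) + ENNReal.ofReal (ε / 2) := by
        rw [← ENNReal.ofReal_mul hCpos.le, mul_div_cancel₀ _ hCpos.ne']
        exact ENNReal.add_lt_add_of_lt_of_le ENNReal.ofReal_ne_top hQ le_rfl
    _ = ENNReal.ofReal ε := by rw [← ENNReal.ofReal_add (by positivity) (by positivity), add_halves]

theorem IsOuter.exists_approx_one {h : Torus → ℂ} (hh : IsOuter h) {ε : ℝ} (hε : 0 < ε) :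
    ∃ P : Polynomial ℂ, MemLp (fun t => 1 - P.eval (zeta t) * h t) 2 m ∧
      eLpNorm (fun t => 1 - P.eval (zeta t) * h t) 2 m < ENNReal.ofReal ε := by
  obtain ⟨P, hP⟩ := hh.2 _ memHardy_one ε hε
  exact ⟨P, (memLp_const 1).sub (memLp_eval_zeta_mul P hh.1.1), hP⟩

/-- On the zero set of h the function 1 - Ph equals 1, so Chebyshev's inequality bounds the measure
of that set by the squared norm of 1 - Ph. -/
theorem IsOuter.ae_ne_zero {h : Torus → ℂ} (hh : IsOuter h) : ∀ᵐ t ∂m, h t ≠ 0 := by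
  rw [ae_iff]
  refine le_antisymm (ENNReal.le_of_forall_pos_le_add fun ε hε _ => ?_) zero_le
  rw [zero_add]
  obtain ⟨P, hP, hlt⟩ := hh.exists_approx_one (ε := Real.sqrt ε) (Real.sqrt_pos.2 hε)
  have h1 := mul_meas_ge_le_pow_eLpNorm' m two_ne_zero ENNReal.ofNat_ne_top hP.1 1
  rw [ENNReal.one_rpow, one_mul] at h1
  calc m {t | ¬ h t ≠ 0} ≤ m {t | 1 ≤ ‖1 - P.eval (zeta t) * h t‖ₑ} := by
        refine measure_mono fun t ht => ?_
        simp only [Set.mem_ofPred_eq, not_not] at ht ⊢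
        simp [ht]
    _ ≤ _ := h1
    _ ≤ ENNReal.ofReal (Real.sqrt ε) ^ (2 : ℝ≥0∞).toReal := by
        exact ENNReal.rpow_le_rpow hlt.le (by norm_num)
    _ = ε := by
        rw [ENNReal.toReal_ofNat, ENNReal.rpow_ofNat, ← ENNReal.ofReal_pow (Real.sqrt_nonneg _),
          Real.sq_sqrt ε.coe_nonneg, ENNReal.ofReal_coe_nnreal]

/-- An outer factor can be cancelled without leaving the Hardy class. -/
theorem IsOuter.fourierCoeff_eq_zero_of_mul {h f : Torus → ℂ} (hh : IsOuter h) (hf : MemLp f 2 m)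
    (hfh : ∀ n : ℤ, n < 0 → fourierCoeff (fun t => f t * h t) n = 0) {n : ℤ} (hn : n < 0) :
    fourierCoeff f n = 0 := by
  rw [← norm_le_zero_iff]
  refine le_of_forall_pos_le_add fun ε hε => ?_
  rw [zero_add]
  have hA : 0 < (eLpNorm f 2 m).toReal + 1 := by positivity
  obtain ⟨P, hP, hlt⟩ := hh.exists_approx_one (div_pos hε hA)
  have hfh' := integrable_mul_of_memLp_two hf hh.1.1
  have h1 : fourierCoeff (fun t => P.eval (zeta t) * (f t * h t)) n = 0 :=
    fourierCoeff_eval_zeta_mul_eq_zero hfh' hfh P hn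
  have hi : Integrable (fun t => P.eval (zeta t) * (f t * h t)) m :=
    memLp_one_iff_integrable.1 (memLp_eval_zeta_mul P (memLp_one_iff_integrable.2 hfh'))
  -- The n-th coefficient of Pfh vanishes, so replacing f by f(1 - Ph) does not change the
  -- coefficient; Cauchy–Schwarz then makes it small.
  have h2 : fourierCoeff f n =
      ∫ t, (fourier (-n) t * f t) * (1 - P.eval (zeta t) * h t) ∂m := by
    have := fourierCoeff_sub (integrable_of_memLp_two hf) hi n
    rw [h1, sub_zero] at this
    rw [← this]
    refine integral_congr_ae (Eventually.of_forall fun t => ?_)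
    simp only [smul_eq_mul]; ring
  rw [h2]
  refine (norm_integral_mul_le (memLp_fourier_mul (-n) hf) hP).trans ?_
  have h3 : (eLpNorm (fun t => fourier (-n) t * f t) 2 m).toReal = (eLpNorm f 2 m).toReal := by
    congr 1
    exact eLpNorm_congr_norm_ae (Eventually.of_forall fun t => by
      rw [norm_mul, norm_fourier_apply, one_mul])
  rw [h3]
  have h4 := (ENNReal.lt_ofReal_iff_toReal_lt hP.2.ne).1 hlt
  calc _ ≤ ((eLpNorm f 2 m).toReal + 1) * (ε / ((eLpNorm f 2 m).toReal + 1)) := by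
        gcongr; linarith
    _ = ε := mul_div_cancel₀ _ hA.ne'

/-! ### Szegő's theorem by orthogonal projection. -/

lemma inner_toLp_eq_integral {f g : Torus → ℂ} (hf : MemLp f 2 m) (hg : MemLp g 2 m) :
    inner ℂ (hf.toLp f) (hg.toLp g) = ∫ t, conj (f t) * g t ∂m := by
  rw [← inner_toLp_conj (memLp_conj hf) hg]
  simp only [Complex.conj_conj]

/-- The orthogonal projection step of Szegő's theorem: if `u` does not lie in the closed span of
the functions `z ^ j * u`, `j ≥ 1`, then some `v` orthogonal to these functions has constant modulus
and lies in the closed span of the `z ^ j * u`, `j ≥ 0`. -/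
theorem exists_norm_eq_const_orthogonal {u w : Torus → ℂ} (hu : MemLp u 2 m) (hw : MemLp w 2 m)
    (hwu : ∀ j : ℕ, ∫ t, w t * (zeta t ^ (j + 1) * u t) ∂m = 0) (hwu0 : ∫ t, w t * u t ∂m ≠ 0) :
    ∃ (v : Torus → ℂ) (s : ℝ), 0 < s ∧ MemLp v 2 m ∧ (∀ᵐ t ∂m, ‖v t‖ = s) ∧
      (∀ j : ℕ, ∫ t, conj (v t) * (zeta t ^ (j + 1) * u t) ∂m = 0) ∧
      ∀ ε : ℝ, 0 < ε → ∃ P : Polynomial ℂ,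
        eLpNorm (fun t => v t - P.eval (zeta t) * u t) 2 m < ENNReal.ofReal ε := by
  have hm : ∀ P : Polynomial ℂ, MemLp (fun t => (Polynomial.X * P).eval (zeta t) * u t) 2 m :=
    fun P => memLp_eval_zeta_mul _ hu
  let S : Polynomial ℂ →ₗ[ℂ] Lp ℂ 2 m :=
    { toFun := fun P => (hm P).toLp _
      map_add' := fun P Q => by
        rw [← MemLp.toLp_add]
        congr 1
        ext t; simp [mul_add, add_mul]
      map_smul' := fun c P => by
        rw [RingHom.id_apply, ← MemLp.toLp_const_smul]
        congr 1
        ext t; simp [mul_assoc] }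
  let N : Submodule ℂ (Lp ℂ 2 m) := (LinearMap.range S).topologicalClosure
  have hNc : IsClosed (N : Set (Lp ℂ 2 m)) := Submodule.isClosed_topologicalClosure _
  have : CompleteSpace N := hNc.completeSpace_coe
  let V : Lp ℂ 2 m := hu.toLp u - N.starProjection (hu.toLp u)
  have hVN : V ∈ Nᗮ := Submodule.sub_starProjection_mem_orthogonal _
  -- The functional defined by w vanishes on N but not at u, so u is not in N.
  have hV0 : V ≠ 0 := by
    intro h0
    have huN : hu.toLp u ∈ N := by
      rw [sub_eq_zero.1 h0]; exact Submodule.starProjection_apply_mem _ _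
    have hle : N ≤ LinearMap.ker (innerSL ℂ ((memLp_conj hw).toLp _) : Lp ℂ 2 m →ₗ[ℂ] ℂ) := by
      refine Submodule.topologicalClosure_minimal _ ?_ (innerSL ℂ ((memLp_conj hw).toLp _)).isClosed_ker
      rintro _ ⟨P, rfl⟩
      change inner ℂ ((memLp_conj hw).toLp _) ((hm P).toLp _) = 0
      rw [inner_toLp_conj hw (hm P)]
      have : (fun t => w t * ((Polynomial.X * P).eval (zeta t) * u t)) = fun t =>
          ∑ i ∈ Finset.range (P.natDegree + 1), P.coeff i * (w t * (zeta t ^ (i + 1) * u t)) := by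
        ext t
        rw [Polynomial.eval_mul, Polynomial.eval_X, Polynomial.eval_eq_sum_range, Finset.mul_sum,
          Finset.sum_mul, Finset.mul_sum]
        exact Finset.sum_congr rfl fun i _ => by ring
      rw [this, integral_finsetSum _ fun i _ => ?_]
      · simp only [integral_const_mul, hwu, mul_zero, Finset.sum_const_zero]
      · refine Integrable.const_mul (integrable_mul_of_memLp_two hw ?_) _
        simp only [zeta_pow]
        exact memLp_fourier_mul _ hu
    have := hle huN
    rw [LinearMap.mem_ker] at this
    change inner ℂ ((memLp_conj hw).toLp _) (hu.toLp u) = 0 at this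
    rw [inner_toLp_conj hw hu] at this
    exact hwu0 this
  let v : Torus → ℂ := V
  have hv : MemLp v 2 m := Lp.memLp V
  have hvV : hv.toLp v = V := Lp.toLp_coeFn V _
  have hort : ∀ P : Polynomial ℂ,
      ∫ t, conj (v t) * ((Polynomial.X * P).eval (zeta t) * u t) ∂m = 0 := fun P => by
    rw [← inner_toLp_eq_integral hv (hm P), hvV]
    exact Submodule.inner_left_of_mem_orthogonal (show (hm P).toLp _ ∈ N from
      Submodule.le_topologicalClosure (LinearMap.range S) (LinearMap.mem_range_self S P)) hVN
  have happ : ∀ ε : ℝ, 0 < ε → ∃ P : Polynomial ℂ,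
        eLpNorm (fun t => v t - P.eval (zeta t) * u t) 2 m < ENNReal.ofReal ε := by
    intro ε hε
    have hmem : N.starProjection (hu.toLp u) ∈ closure (LinearMap.range S : Set (Lp ℂ 2 m)) := by
      rw [← Submodule.topologicalClosure_coe]; exact Submodule.starProjection_apply_mem _ _
    obtain ⟨_, ⟨P, rfl⟩, hP⟩ := Metric.mem_closure_iff.1 hmem ε hε
    -- The projection of u is close to zPu, hence v is close to u - zPu.
    refine ⟨1 - Polynomial.X * P, ?_⟩
    have hmP := memLp_eval_zeta_mul (1 - Polynomial.X * P) hu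
    have h1 : hmP.toLp _ = hu.toLp u - S P := by
      change _ = hu.toLp u - (hm P).toLp _
      rw [← MemLp.toLp_sub]
      congr 1
      ext t; simp only [Polynomial.eval_sub, Polynomial.eval_one, Pi.sub_apply]; ring
    have h2 : ‖V - hmP.toLp _‖ < ε := by
      rw [h1, sub_sub_sub_cancel_left, ← dist_eq_norm, dist_comm]; exact hP
    rw [← hvV, ← MemLp.toLp_sub, Lp.norm_toLp] at h2
    exact (ENNReal.lt_ofReal_iff_toReal_lt (hv.sub hmP).2.ne).2 h2
  -- z^(n+1) v is approximated by z^(n+1) P u, which lies in the space orthogonal to v.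
  have hauto : ∀ n : ℕ, ∫ t, conj (v t) * (zeta t ^ (n + 1) * v t) ∂m = 0 := by
    intro n
    rw [← norm_le_zero_iff]
    refine le_of_forall_pos_le_add fun ε hε => ?_
    rw [zero_add]
    have hA : 0 < (eLpNorm v 2 m).toReal + 1 := by positivity
    obtain ⟨P, hlt⟩ := happ _ (div_pos hε hA)
    have hd : MemLp (fun t => v t - P.eval (zeta t) * u t) 2 m := hv.sub (memLp_eval_zeta_mul P hu)
    have hz : MemLp (fun t => zeta t ^ (n + 1) * (v t - P.eval (zeta t) * u t)) 2 m := by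
      simp only [zeta_pow]; exact memLp_fourier_mul _ hd
    have hzv : MemLp (fun t => zeta t ^ (n + 1) * v t) 2 m := by
      simp only [zeta_pow]; exact memLp_fourier_mul _ hv
    have h1 : ∫ t, conj (v t) * (zeta t ^ (n + 1) * v t) ∂m =
        ∫ t, conj (v t) * (zeta t ^ (n + 1) * (v t - P.eval (zeta t) * u t)) ∂m := by
      rw [← sub_zero (∫ t, conj (v t) * (zeta t ^ (n + 1) * v t) ∂m),
        ← hort (Polynomial.X ^ n * P), ← integral_sub (integrable_mul_of_memLp_two (memLp_conj hv) hzv)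
          (integrable_mul_of_memLp_two (memLp_conj hv) (hm _))]
      refine integral_congr_ae (Eventually.of_forall fun t => ?_)
      simp only [Polynomial.eval_mul, Polynomial.eval_X, Polynomial.eval_pow]; ring
    rw [h1]
    refine (norm_integral_mul_le (memLp_conj hv) hz).trans ?_
    have h3 : eLpNorm (fun t => zeta t ^ (n + 1) * (v t - P.eval (zeta t) * u t)) 2 m =
        eLpNorm (fun t => v t - P.eval (zeta t) * u t) 2 m :=
      eLpNorm_congr_norm_ae (Eventually.of_forall fun t => by
        rw [norm_mul, norm_pow, norm_zeta, one_pow, one_mul])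
    have h5 : eLpNorm (fun t => conj (v t)) 2 m = eLpNorm v 2 m :=
      eLpNorm_congr_norm_ae (Eventually.of_forall fun t => RCLike.norm_conj _)
    rw [h3, h5]
    have h4 := (ENNReal.lt_ofReal_iff_toReal_lt hd.2.ne).1 hlt
    calc _ ≤ ((eLpNorm v 2 m).toReal + 1) * (ε / ((eLpNorm v 2 m).toReal + 1)) := by
          gcongr; linarith
      _ = ε := mul_div_cancel₀ _ hA.ne'
  have hint : Integrable (fun t => conj (v t) * v t) m :=
    integrable_mul_of_memLp_two (memLp_conj hv) hv
  have hneg : ∀ n : ℕ, fourierCoeff (fun t => conj (v t) * v t) (-(n + 1 : ℤ)) = 0 := fun n => by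
    rw [← integral_fourier_mul, ← hauto n]
    refine integral_congr_ae (Eventually.of_forall fun t => ?_)
    simp only [zeta_pow]; push_cast; ring
  have hposc : ∀ n : ℕ, fourierCoeff (fun t => conj (v t) * v t) (n + 1 : ℤ) = 0 := fun n => by
    have := congrArg conj (hneg n)
    rw [map_zero] at this
    rw [← this]
    unfold fourierCoeff
    rw [← integral_conj]
    refine integral_congr_ae (Eventually.of_forall fun t => ?_)
    simp only [smul_eq_mul, map_mul, Complex.conj_conj, ← fourier_neg, neg_neg]; ring
  let c : ℂ := fourierCoeff (fun t => conj (v t) * v t) 0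
  have hc : c = ((‖V‖ ^ 2 : ℝ) : ℂ) := by
    have h := inner_self_eq_norm_sq_to_K (𝕜 := ℂ) V
    rw [← hvV, inner_toLp_eq_integral hv hv] at h
    rw [← hvV]
    simp only [c, fourierCoeff, neg_zero, fourier_zero, one_smul]
    rw [h]; simp
  -- Only the coefficient of index 0 of |v|² survives, so |v|² is constant.
  have hconst : (fun t => conj (v t) * v t) =ᵐ[m] fun t => c * fourier 0 t := by
    refine ae_eq_of_fourierCoeff_eq hint
      ((memLp_of_continuous (map_continuous (fourier 0)) 1).integrable le_rfl |>.const_mul c) ?_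
    intro n
    rw [fourierCoeff.const_mul, fourierCoeff_fourier]
    rcases lt_trichotomy n 0 with hn | hn | hn
    · obtain ⟨k, rfl⟩ : ∃ k : ℕ, n = -(k + 1 : ℤ) := ⟨(-n - 1).toNat, by omega⟩
      rw [hneg, Pi.single_eq_of_ne hn.ne, mul_zero]
    · subst hn; simp [c]
    · obtain ⟨k, rfl⟩ : ∃ k : ℕ, n = (k + 1 : ℤ) := ⟨(n - 1).toNat, by omega⟩
      rw [hposc, Pi.single_eq_of_ne hn.ne', mul_zero]
  refine ⟨v, ‖V‖, norm_pos_iff.2 hV0, hv, ?_, fun j => ?_, happ⟩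
  · filter_upwards [hconst] with t ht
    rw [fourier_zero, mul_one, Complex.conj_mul', hc] at ht
    exact (pow_left_inj₀ (norm_nonneg _) (norm_nonneg _) two_ne_zero).1 (by exact_mod_cast ht)
  · rw [← hort (Polynomial.X ^ j)]
    refine integral_congr_ae (Eventually.of_forall fun t => ?_)
    simp only [Polynomial.eval_mul, Polynomial.eval_X, Polynomial.eval_pow]; ring

/-- Szegő's theorem: `|u|` is the modulus of an outer function if `u` does not lie in the closed
span of the functions `z ^ j * u`, `j ≥ 1`. -/
theorem exists_isOuter_norm_eq {u w : Torus → ℂ} (hu : MemLp u 2 m) (hw : MemLp w 2 m)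
    (hwu : ∀ j : ℕ, ∫ t, w t * (zeta t ^ (j + 1) * u t) ∂m = 0) (hwu0 : ∫ t, w t * u t ∂m ≠ 0) :
    ∃ h : Torus → ℂ, IsOuter h ∧ ∀ᵐ t ∂m, ‖h t‖ = ‖u t‖ := by
  obtain ⟨v, s, hs, hv, hvs, hort, happ⟩ := exists_norm_eq_const_orthogonal hu hw hwu hwu0
  -- Since |v| = s, this has the modulus of u, and the orthogonality of v to z^(j+1) u says that its
  -- negative coefficients vanish.
  let h : Torus → ℂ := fun t => (s : ℂ)⁻¹ * (conj (v t) * u t)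
  have hnorm : ∀ᵐ t ∂m, ‖h t‖ = ‖u t‖ := by
    filter_upwards [hvs] with t ht
    simp only [h, norm_mul, RCLike.norm_conj, ht, norm_inv, Complex.norm_real, Real.norm_eq_abs,
      abs_of_pos hs]
    field_simp
  have hh : MemLp h 2 m := by
    refine hu.of_le (((memLp_conj hv).1.mul hu.1).const_mul _) ?_
    filter_upwards [hnorm] with t ht using ht.le
  have hH : MemHardy h 2 := by
    refine ⟨hh, fun n hn => ?_⟩
    obtain ⟨k, rfl⟩ : ∃ k : ℕ, n = -(k + 1 : ℤ) := ⟨(-n - 1).toNat, by omega⟩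
    rw [fourierCoeff.const_mul, ← integral_fourier_mul]
    rw [mul_eq_zero]; right
    rw [← hort k]
    refine integral_congr_ae (Eventually.of_forall fun t => ?_)
    simp only [zeta_pow]; push_cast; ring
  refine ⟨h, isOuter_of_forall_approx_one hH fun ε hε => ?_, hnorm⟩
  obtain ⟨P, hP⟩ := happ (s * ε) (by positivity)
  refine ⟨Polynomial.C (s : ℂ)⁻¹ * P, ?_⟩
  have hle : eLpNorm (fun t => 1 - (Polynomial.C (s : ℂ)⁻¹ * P).eval (zeta t) * h t) 2 m ≤
      ENNReal.ofReal s⁻¹ * eLpNorm (fun t => v t - P.eval (zeta t) * u t) 2 m := by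
    refine eLpNorm_le_mul_eLpNorm_of_ae_le_mul ?_ 2
    filter_upwards [hvs] with t ht
    have hs' : (s : ℂ) ≠ 0 := by exact_mod_cast hs.ne'
    have h1 : conj (v t) * v t = (s : ℂ) ^ 2 := by rw [Complex.conj_mul', ht]
    -- As conj(v) v = s², approximating v by Pu is the same as approximating 1 by P h / s.
    have h2 : 1 - (Polynomial.C (s : ℂ)⁻¹ * P).eval (zeta t) * h t =
        ((s : ℂ) ^ 2)⁻¹ * (conj (v t) * (v t - P.eval (zeta t) * u t)) := by
      rw [mul_sub, h1]
      simp only [h, Polynomial.eval_mul, Polynomial.eval_C]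
      field_simp
    rw [h2, norm_mul, norm_mul, RCLike.norm_conj, ht, norm_inv, norm_pow, Complex.norm_real,
      Real.norm_eq_abs, abs_of_pos hs]
    apply le_of_eq; field_simp
  refine hle.trans_lt ?_
  calc _ < ENNReal.ofReal s⁻¹ * ENNReal.ofReal (s * ε) :=
        ENNReal.mul_lt_mul_right (by simpa using hs) ENNReal.ofReal_ne_top hP
    _ = ENNReal.ofReal ε := by
        rw [← ENNReal.ofReal_mul (by positivity), inv_mul_cancel_left₀ hs.ne']

/-! ### The analytic extension to the disk and logarithms. -/

lemma norm_fourierCoeff_le_integral (f : Torus → ℂ) (n : ℤ) :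
    ‖fourierCoeff f n‖ ≤ ∫ t, ‖f t‖ ∂m := by
  refine (norm_integral_le_integral_norm _).trans (le_of_eq ?_)
  simp only [norm_smul, norm_fourier_apply, one_mul]

lemma summable_norm_fourierCoeff_mul_pow (f : Torus → ℂ) {w : ℂ} (hw : ‖w‖ < 1) :
    Summable fun n : ℕ => ‖fourierCoeff f (n : ℤ) * w ^ n‖ := by
  refine Summable.of_nonneg_of_le (fun _ => norm_nonneg _) (fun n => ?_)
    ((summable_geometric_of_lt_one (norm_nonneg w) hw).mul_left (∫ t, ‖f t‖ ∂m))
  rw [norm_mul, norm_pow]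
  exact mul_le_mul_of_nonneg_right (norm_fourierCoeff_le_integral f n) (by positivity)

lemma hasSum_extension (f : Torus → ℂ) {w : ℂ} (hw : w ∈ Metric.ball (0 : ℂ) 1) :
    HasSum (fun n : ℕ => fourierCoeff f (n : ℤ) * w ^ n) (extension f w) :=
  (summable_norm_fourierCoeff_mul_pow f (mem_ball_zero_iff.1 hw)).of_norm.hasSum

lemma norm_extension_le (f : Torus → ℂ) {w : ℂ} (hw : ‖w‖ < 1) :
    ‖extension f w‖ ≤ (∫ t, ‖f t‖ ∂m) * (1 - ‖w‖)⁻¹ := by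
  refine tsum_of_norm_bounded (HasSum.mul_left _ (hasSum_geometric_of_lt_one (norm_nonneg w) hw))
    fun n => ?_
  rw [norm_mul, norm_pow]
  exact mul_le_mul_of_nonneg_right (norm_fourierCoeff_le_integral f n) (by positivity)

lemma differentiableOn_extension (f : Torus → ℂ) :
    DifferentiableOn ℂ (extension f) (Metric.ball 0 1) := by
  intro w hw
  obtain ⟨r, hwr, hr⟩ := exists_between (mem_ball_zero_iff.1 hw)
  have hr0 : 0 ≤ r := (norm_nonneg w).trans hwr.le
  have h : DifferentiableOn ℂ (fun w => ∑' n : ℕ, fourierCoeff f (n : ℤ) * w ^ n)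
      (Metric.ball 0 r) := by
    refine Complex.differentiableOn_tsum_of_summable_norm
      ((summable_geometric_of_lt_one hr0 hr).mul_left (∫ t, ‖f t‖ ∂m)) (fun n => by fun_prop)
      Metric.isOpen_ball fun n z hz => ?_
    rw [norm_mul, norm_pow]
    exact mul_le_mul (norm_fourierCoeff_le_integral f n)
      (pow_le_pow_left₀ (norm_nonneg _) (mem_ball_zero_iff.1 hz).le n) (by positivity)
      (integral_nonneg fun _ => norm_nonneg _)
  exact (h.differentiableAt (Metric.isOpen_ball.mem_nhds (mem_ball_zero_iff.2 hwr))).differentiableWithinAt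

lemma extension_add {f g : Torus → ℂ} (hf : Integrable f m) (hg : Integrable g m) {w : ℂ}
    (hw : w ∈ Metric.ball (0 : ℂ) 1) :
    extension (fun t => f t + g t) w = extension f w + extension g w := by
  have h := (hasSum_extension f hw).add (hasSum_extension g hw)
  refine ((h.congr_fun fun n => ?_).unique (hasSum_extension (fun t => f t + g t) hw)).symm
  have := congrFun (fourierCoeff.add hf hg) n
  rw [Pi.add_apply] at this
  rw [← add_mul, ← this]
  rfl

lemma extension_const_mul (f : Torus → ℂ) (c w : ℂ) :
    extension (fun t => c * f t) w = c * extension f w := by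
  simp only [extension, fourierCoeff.const_mul, mul_assoc, tsum_mul_left]

lemma extension_zeta_pow_mul {f : Torus → ℂ} (hf : ∀ n : ℤ, n < 0 → fourierCoeff f n = 0) (j : ℕ)
    {w : ℂ} (hw : w ∈ Metric.ball (0 : ℂ) 1) :
    extension (fun t => zeta t ^ j * f t) w = w ^ j * extension f w := by
  have hc : ∀ n : ℕ, fourierCoeff (fun t => zeta t ^ j * f t) (n : ℤ) = fourierCoeff f (n - j) := by
    intro n
    simp only [zeta_pow, fourierCoeff_fourier_mul]
  have h1 : HasSum (fun n : ℕ => fourierCoeff (fun t => zeta t ^ j * f t) ((n + j : ℕ) : ℤ)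
      * w ^ (n + j)) (w ^ j * extension f w) := by
    refine ((hasSum_extension f hw).mul_left (w ^ j)).congr_fun fun n => ?_
    rw [hc, pow_add]; push_cast; rw [add_sub_cancel_right]; ring
  have h2 := (hasSum_nat_add_iff
    (f := fun n : ℕ => fourierCoeff (fun t => zeta t ^ j * f t) (n : ℤ) * w ^ n) j).1 h1
  rw [Finset.sum_eq_zero fun i hi => ?_, add_zero] at h2
  · exact (hasSum_extension _ hw).unique h2
  · rw [hc, hf _ (by have := Finset.mem_range.1 hi; omega), zero_mul]

lemma extension_eval_zeta_mul {f : Torus → ℂ} (hf : MemHardy f 1) (P : Polynomial ℂ)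
    {w : ℂ} (hw : w ∈ Metric.ball (0 : ℂ) 1) :
    extension (fun t => P.eval (zeta t) * f t) w = P.eval w * extension f w := by
  induction P using Polynomial.induction_on' with
  | add p q hp hq =>
    simp only [Polynomial.eval_add, add_mul]
    rw [extension_add (memLp_one_iff_integrable.1 (memLp_eval_zeta_mul p hf.1))
      (memLp_one_iff_integrable.1 (memLp_eval_zeta_mul q hf.1)) hw, hp, hq]
  | monomial n a =>
    simp only [Polynomial.eval_monomial, mul_assoc]
    rw [extension_const_mul, extension_zeta_pow_mul hf.2 n hw]

lemma extension_one (w : ℂ) : extension (fun _ => 1) w = 1 := by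
  have h : (fun _ : Torus => (1 : ℂ)) = fourier 0 := by
    ext t; simp
  rw [extension, tsum_eq_single 0]
  · rw [h, fourierCoeff_fourier]; simp
  · intro n hn
    rw [h, fourierCoeff_fourier, Pi.single_eq_of_ne (by exact_mod_cast hn), zero_mul]

lemma integral_norm_le_eLpNorm_two {f : Torus → ℂ} (hf : MemLp f 2 m) :
    ∫ t, ‖f t‖ ∂m ≤ (eLpNorm f 2 m).toReal := by
  rw [integral_norm_eq_lintegral_enorm hf.1, ← eLpNorm_one_eq_lintegral_enorm]
  exact ENNReal.toReal_mono hf.2.ne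
    (eLpNorm_le_eLpNorm_of_exponent_le (by norm_num) hf.1)

theorem MemHardy.one_of_two {f : Torus → ℂ} (hf : MemHardy f 2) : MemHardy f 1 :=
  ⟨hf.1.mono_exponent (by norm_num), hf.2⟩

/-- An outer function has no zeros in the disk. -/
theorem IsOuter.extension_ne_zero {h : Torus → ℂ} (hh : IsOuter h) {w : ℂ}
    (hw : w ∈ Metric.ball (0 : ℂ) 1) : extension h w ≠ 0 := by
  intro h0
  have hw' : ‖w‖ < 1 := mem_ball_zero_iff.1 hw
  have hpos : 0 < 1 - ‖w‖ := by linarith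
  -- Evaluation at w is bounded by (1 - |w|)⁻¹ times the L¹ norm. At a zero w of the extension of h,
  -- the extension of 1 - Ph would equal 1, which contradicts this accuracy.
  obtain ⟨P, hP, hlt⟩ := hh.exists_approx_one hpos
  have h1 := (ENNReal.lt_ofReal_iff_toReal_lt hP.2.ne).1 hlt
  have hPh := memLp_eval_zeta_mul P hh.1.1
  have h2 : extension (fun t => 1 - P.eval (zeta t) * h t) w = 1 := by
    have := extension_add (f := fun _ => 1) (g := fun t => (-1) * (P.eval (zeta t) * h t))
      (integrable_of_memLp_two memHardy_one.1) ((integrable_of_memLp_two hPh).const_mul _) hw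
    rw [extension_one, extension_const_mul, extension_eval_zeta_mul hh.1.one_of_two P hw, h0] at this
    simpa [sub_eq_add_neg] using this
  have h3 := norm_extension_le (fun t => 1 - P.eval (zeta t) * h t) hw'
  rw [h2, norm_one] at h3
  have h4 := integral_norm_le_eLpNorm_two hP
  have h5 : (∫ t, ‖1 - P.eval (zeta t) * h t‖ ∂m) * (1 - ‖w‖)⁻¹ < (1 - ‖w‖) * (1 - ‖w‖)⁻¹ :=
    mul_lt_mul_of_pos_right (h4.trans_lt h1) (inv_pos.2 hpos)
  rw [mul_inv_cancel₀ hpos.ne'] at h5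
  linarith

/-- A zero-free holomorphic function on the unit disk has a holomorphic logarithm. -/
theorem exists_differentiableOn_exp_eq {F : ℂ → ℂ} (hF : DifferentiableOn ℂ F (Metric.ball 0 1))
    (h0 : ∀ w ∈ Metric.ball (0 : ℂ) 1, F w ≠ 0) :
    ∃ L : ℂ → ℂ, DifferentiableOn ℂ L (Metric.ball 0 1) ∧
      ∀ w ∈ Metric.ball (0 : ℂ) 1, Complex.exp (L w) = F w := by
  have hd : DifferentiableOn ℂ (fun w => deriv F w / F w) (Metric.ball 0 1) :=
    (hF.deriv Metric.isOpen_ball).div hF h0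
  have hz : (0 : ℂ) ∈ Metric.ball (0 : ℂ) 1 := Metric.mem_ball_self one_pos
  obtain ⟨L, hL0, hL⟩ := hd.isExactOn_ball.with_val_at 0 (Complex.log (F 0))
  refine ⟨L, fun w hw => (hL w hw).differentiableAt.differentiableWithinAt, fun w hw => ?_⟩
  -- L is a primitive of F'/F with L(0) = log F(0), so F e^(-L) is constant, with value 1 at the
  -- centre.
  have hder : ∀ z ∈ Metric.ball (0 : ℂ) 1,
      HasDerivAt (fun z => F z * Complex.exp (-L z)) 0 z := fun z hzz => by
    have h1 := (hF.differentiableAt (Metric.isOpen_ball.mem_nhds hzz)).hasDerivAt.mul (hL z hzz).neg.cexp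
    rw [mul_neg, mul_neg, mul_left_comm (F z), mul_div_cancel₀ _ (h0 z hzz), mul_comm (deriv F z), add_neg_cancel] at h1
    exact h1
  have hc := Metric.isOpen_ball.is_const_of_deriv_eq_zero (convex_ball (0 : ℂ) 1).isPreconnected
    (fun z hzz => (hder z hzz).differentiableAt.differentiableWithinAt)
    (fun z hzz => (hder z hzz).deriv) hw hz
  simp only [hL0, Complex.exp_neg, Complex.exp_log (h0 0 hz), mul_inv_cancel₀ (h0 0 hz)] at hc
  exact ((mul_inv_eq_one₀ (Complex.exp_ne_zero _)).1 hc).symm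

/-! ### Power series on circles of radius less than 1. -/

lemma mul_zeta_mem_ball {r : ℝ} (hr : r ∈ Set.Ico (0 : ℝ) 1) (t : Torus) :
    (r : ℂ) * zeta t ∈ Metric.ball (0 : ℂ) 1 := by
  rw [mem_ball_zero_iff, norm_mul, norm_zeta, mul_one, Complex.norm_real, Real.norm_eq_abs,
    abs_of_nonneg hr.1]
  exact hr.2

section PowerSeries

variable {c : ℕ → ℂ} {K : ℂ → ℂ}

lemma summable_norm_mul_pow (hK : ∀ w ∈ Metric.ball (0 : ℂ) 1, HasSum (fun n => c n * w ^ n) (K w))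
    {r : ℝ} (hr : r ∈ Set.Ico (0 : ℝ) 1) : Summable fun n => ‖c n‖ * r ^ n := by
  have h := (hK (r : ℂ) (by simpa [abs_of_nonneg hr.1] using hr.2)).summable.norm
  simpa [abs_of_nonneg hr.1] using h

lemma continuous_circle (hK : ∀ w ∈ Metric.ball (0 : ℂ) 1, HasSum (fun n => c n * w ^ n) (K w))
    {r : ℝ} (hr : r ∈ Set.Ico (0 : ℝ) 1) : Continuous fun t => K (r * zeta t) := by
  have h : (fun t => K (r * zeta t)) = fun t => ∑' n, c n * (r * zeta t) ^ n :=
    funext fun t => (hK _ (mul_zeta_mem_ball hr t)).tsum_eq.symm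
  rw [h]
  refine continuous_tsum (fun n => ?_) (summable_norm_mul_pow hK hr) fun n t => ?_
  · have := continuous_zeta
    fun_prop
  · simp [norm_zeta, abs_of_nonneg hr.1]

lemma fourierCoeff_circle (hK : ∀ w ∈ Metric.ball (0 : ℂ) 1, HasSum (fun n => c n * w ^ n) (K w))
    {r : ℝ} (hr : r ∈ Set.Ico (0 : ℝ) 1) (k : ℤ) :
    fourierCoeff (fun t => K (r * zeta t)) k = if 0 ≤ k then c k.toNat * r ^ k.toNat else 0 := by
  have hF : ∀ n : ℕ, Continuous fun t : Torus => fourier (-k) t * (c n * (r * zeta t) ^ n) := by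
    intro n
    have := continuous_zeta
    have := map_continuous (fourier (T := 2 * Real.pi) (-k))
    fun_prop
  have h1 := hasSum_integral_of_summable_integral_norm (μ := m)
    (F := fun n t => fourier (-k) t * (c n * (r * zeta t) ^ n))
    (fun n => (memLp_of_continuous (hF n) 1).integrable le_rfl) (by
      simpa only [norm_mul, norm_fourier_apply, norm_pow, norm_zeta, Complex.norm_real, mul_one,
        Real.norm_eq_abs, abs_of_nonneg hr.1, one_mul, integral_const, probReal_univ, one_smul]
        using summable_norm_mul_pow hK hr)
  have h2 : fourierCoeff (fun t => K (r * zeta t)) k =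
      ∫ t, ∑' n, fourier (-k) t * (c n * (r * zeta t) ^ n) ∂m := by
    refine integral_congr_ae (Eventually.of_forall fun t => ?_)
    simp only [smul_eq_mul]
    rw [tsum_mul_left, (hK _ (mul_zeta_mem_ball hr t)).tsum_eq]
  have h3 : ∀ n : ℕ, ∫ t, fourier (-k) t * (c n * (r * zeta t) ^ n) ∂m =
      if k = n then c n * r ^ n else 0 := by
    intro n
    have : (fun t => fourier (-k) t * (c n * (r * zeta t) ^ n)) =
        fun t => (c n * r ^ n) * (fourier (-k) t * fourier (n : ℤ) t) := by
      ext t; rw [mul_pow, zeta_pow]; ring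
    rw [this, integral_const_mul]
    have h4 : ∫ t, fourier (-k) t * fourier (n : ℤ) t ∂m = fourierCoeff (fourier (T := 2 * Real.pi) (n : ℤ)) k := rfl
    rw [h4, fourierCoeff_fourier, Pi.single_apply, mul_ite, mul_one, mul_zero]
  rw [h2, ← h1.tsum_eq]
  simp only [h3]
  split_ifs with hk
  · rw [tsum_eq_single k.toNat]
    · rw [if_pos (by omega)]
    · intro n hn
      rw [if_neg (by omega)]
  · convert tsum_zero with n
    rw [if_neg (by omega)]

/-- Parseval's identity on the circle of radius `r`. -/
lemma hasSum_sq_norm_circle (hK : ∀ w ∈ Metric.ball (0 : ℂ) 1, HasSum (fun n => c n * w ^ n) (K w))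
    {r : ℝ} (hr : r ∈ Set.Ico (0 : ℝ) 1) :
    HasSum (fun n => (‖c n‖ * r ^ n) ^ 2) ((eLpNorm (fun t => K (r * zeta t)) 2 m).toReal ^ 2) := by
  have h := hasSum_sq_norm_fourierCoeff (memLp_of_continuous (continuous_circle hK hr) 2)
  simp only [fourierCoeff_circle hK hr] at h
  refine ((Function.Injective.hasSum_iff (g := fun n : ℕ => (n : ℤ)) Nat.cast_injective ?_).2 h).congr_fun
    fun n => ?_
  · intro k hk
    rw [if_neg]
    · simp
    · intro h0
      exact hk ⟨k.toNat, by simp; omega⟩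
  · simp [abs_of_nonneg hr.1]

/-- A holomorphic function dominated by `1 + |H|` with `H` of class `H²` has square summable Taylor
coefficients. -/
theorem summable_sq_norm_of_norm_le_one_add {d : ℕ → ℂ} {H : ℂ → ℂ}
    (hK : ∀ w ∈ Metric.ball (0 : ℂ) 1, HasSum (fun n => c n * w ^ n) (K w))
    (hH : ∀ w ∈ Metric.ball (0 : ℂ) 1, HasSum (fun n => d n * w ^ n) (H w))
    (hd : Summable fun n => ‖d n‖ ^ 2) (hle : ∀ w ∈ Metric.ball (0 : ℂ) 1, ‖K w‖ ≤ 1 + ‖H w‖) :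
    Summable fun n => ‖c n‖ ^ 2 := by
  set S := ∑' n, ‖d n‖ ^ 2
  refine summable_of_sum_range_le (c := (1 + Real.sqrt S) ^ 2) (fun _ => by positivity) fun N => ?_
  -- Parseval on the circle of radius r turns the pointwise bound into one independent of r and N;
  -- afterwards r tends to 1 in a finite sum.
  have hr : ∀ r ∈ Set.Ico (0 : ℝ) 1,
      ∑ i ∈ Finset.range N, (‖c i‖ * r ^ i) ^ 2 ≤ (1 + Real.sqrt S) ^ 2 := by
    intro r hr
    have h1 := hasSum_sq_norm_circle hK hr
    have h2 := hasSum_sq_norm_circle hH hr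
    have h3 : (eLpNorm (fun t => H (r * zeta t)) 2 m).toReal ≤ Real.sqrt S := by
      refine Real.le_sqrt_of_sq_le ?_
      rw [← h2.tsum_eq]
      refine h2.summable.tsum_le_tsum (fun n => ?_) hd
      exact pow_le_pow_left₀ (mul_nonneg (norm_nonneg _) (pow_nonneg hr.1 _))
        (mul_le_of_le_one_right (norm_nonneg _) (pow_le_one₀ hr.1 hr.2.le)) 2
    have hHm : MemLp (fun t => ‖H (r * zeta t)‖) 2 m :=
      (memLp_of_continuous (continuous_circle hH hr) 2).norm
    have h4 : eLpNorm (fun t => K (r * zeta t)) 2 m ≤ 1 + eLpNorm (fun t => H (r * zeta t)) 2 m := by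
      calc _ ≤ eLpNorm ((fun _ => (1 : ℝ)) + fun t => ‖H (r * zeta t)‖) 2 m := by
            refine eLpNorm_mono_real fun t => ?_
            exact hle _ (mul_zeta_mem_ball hr t)
        _ ≤ eLpNorm (fun _ : Torus => (1 : ℝ)) 2 m + eLpNorm (fun t => ‖H (r * zeta t)‖) 2 m :=
            eLpNorm_add_le aestronglyMeasurable_const hHm.1 (by norm_num)
        _ = _ := by
            rw [eLpNorm_norm, eLpNorm_const _ (by norm_num) (IsProbabilityMeasure.ne_zero _)]
            simp
    have hHf := (memLp_of_continuous (continuous_circle hH hr) 2).2.ne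
    have h5 : (eLpNorm (fun t => K (r * zeta t)) 2 m).toReal ≤ 1 + Real.sqrt S := by
      refine (ENNReal.toReal_mono (by finiteness) h4).trans ?_
      rw [ENNReal.toReal_add (by finiteness) hHf, ENNReal.toReal_one]
      linarith
    refine (h1.summable.sum_le_tsum _ fun _ _ => by positivity).trans ?_
    rw [h1.tsum_eq]
    exact pow_le_pow_left₀ ENNReal.toReal_nonneg h5 2
  have hlim : Tendsto (fun r : ℝ => ∑ i ∈ Finset.range N, (‖c i‖ * r ^ i) ^ 2) (𝓝[<] 1)
      (𝓝 (∑ i ∈ Finset.range N, (‖c i‖ * 1 ^ i) ^ 2)) := by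
    refine Tendsto.mono_left (Continuous.tendsto ?_ 1) nhdsWithin_le_nhds
    fun_prop
  simp only [one_pow, mul_one] at hlim
  refine le_of_tendsto hlim ?_
  filter_upwards [Ico_mem_nhdsLT (show (0 : ℝ) < 1 by norm_num)] with r h using hr r h

end PowerSeries

/-! ### Radial limits of H² functions. -/

lemma summable_sq_norm_fourierCoeff_nat {f : Torus → ℂ} (hf : MemLp f 2 m) :
    Summable fun n : ℕ => ‖fourierCoeff f (n : ℤ)‖ ^ 2 :=
  (hasSum_sq_norm_fourierCoeff hf).summable.comp_injective Nat.cast_injective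

/-- Functions of class `H²` are the limits of their dilations in the `L²` norm. -/
theorem tendsto_eLpNorm_extension_sub {f : Torus → ℂ} (hf : MemHardy f 2) :
    Tendsto (fun r : ℝ => eLpNorm ((fun t => extension f (r * zeta t)) - f) 2 m) (𝓝[<] 1) (𝓝 0) := by
  have hmem : ∀ r ∈ Set.Ico (0 : ℝ) 1, MemLp (fun t => extension f (r * zeta t)) 2 m :=
    fun r hr => memLp_of_continuous (continuous_circle (fun w hw => hasSum_extension f hw) hr) 2
  have hsq : ∀ r ∈ Set.Ico (0 : ℝ) 1,
      (eLpNorm ((fun t => extension f (r * zeta t)) - f) 2 m).toReal ^ 2 =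
        ∑' i : ℤ, ‖fourierCoeff f i‖ ^ 2 * (r ^ i.toNat - 1) ^ 2 := by
    intro r hr
    rw [← (hasSum_sq_norm_fourierCoeff ((hmem r hr).sub hf.1)).tsum_eq]
    refine tsum_congr fun i => ?_
    have h1 := fourierCoeff_sub (integrable_of_memLp_two (hmem r hr))
      (integrable_of_memLp_two hf.1) i
    have h2 : fourierCoeff ((fun t => extension f (r * zeta t)) - f) i =
        fourierCoeff f i * ((r ^ i.toNat - 1 : ℝ) : ℂ) := by
      refine Eq.trans h1 ?_
      rw [fourierCoeff_circle (fun w hw => hasSum_extension f hw) hr]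
      split_ifs with hi
      · rw [Int.toNat_of_nonneg hi]; push_cast; ring
      · rw [hf.2 i (by omega)]; simp
    rw [h2, norm_mul, mul_pow, Complex.norm_real, Real.norm_eq_abs, sq_abs]
  have hlim : Tendsto (fun r : ℝ => ∑' i : ℤ, ‖fourierCoeff f i‖ ^ 2 * (r ^ i.toNat - 1) ^ 2)
      (𝓝[<] 1) (𝓝 (∑' _ : ℤ, 0)) := by
    refine tendsto_tsum_of_dominated_convergence
      (bound := fun i => ‖fourierCoeff f i‖ ^ 2) (hasSum_sq_norm_fourierCoeff hf.1).summable ?_ ?_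
    · intro i
      refine Tendsto.mono_left ?_ nhdsWithin_le_nhds
      have : Continuous fun r : ℝ => ‖fourierCoeff f i‖ ^ 2 * (r ^ i.toNat - 1) ^ 2 := by fun_prop
      simpa using this.tendsto 1
    · filter_upwards [Ico_mem_nhdsLT (show (0 : ℝ) < 1 by norm_num)] with r hr i
      rw [Real.norm_of_nonneg (by positivity)]
      refine mul_le_of_le_one_right (by positivity) ?_
      have h1 : r ^ i.toNat ≤ 1 := pow_le_one₀ hr.1 hr.2.le
      have h2 : 0 ≤ r ^ i.toNat := pow_nonneg hr.1 _
      nlinarith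
  rw [tsum_zero] at hlim
  have h3 : Tendsto (fun r : ℝ =>
      (eLpNorm ((fun t => extension f (r * zeta t)) - f) 2 m).toReal) (𝓝[<] 1) (𝓝 0) := by
    have h4 := (Real.continuous_sqrt.tendsto 0).comp hlim
    rw [Real.sqrt_zero] at h4
    refine h4.congr' ?_
    filter_upwards [Ico_mem_nhdsLT (show (0 : ℝ) < 1 by norm_num)] with r hr
    rw [Function.comp_apply, ← hsq r hr, Real.sqrt_sq ENNReal.toReal_nonneg]
  have h5 := ENNReal.tendsto_ofReal h3
  rw [ENNReal.ofReal_zero] at h5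
  refine h5.congr' ?_
  filter_upwards [Ico_mem_nhdsLT (show (0 : ℝ) < 1 by norm_num)] with r hr
  exact ENNReal.ofReal_toReal ((hmem r hr).sub hf.1).2.ne

/-- Radial limits almost everywhere along a subsequence. -/
theorem exists_subseq_tendsto_extension {f : Torus → ℂ} (hf : MemHardy f 2) {r : ℕ → ℝ}
    (hr : ∀ j, r j ∈ Set.Ico (0 : ℝ) 1) (hr1 : Tendsto r atTop (𝓝 1)) :
    ∃ ns : ℕ → ℕ, StrictMono ns ∧
      ∀ᵐ t ∂m, Tendsto (fun j => extension f (r (ns j) * zeta t)) atTop (𝓝 (f t)) := by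
  have h1 : Tendsto r atTop (𝓝[<] 1) :=
    tendsto_nhdsWithin_iff.2 ⟨hr1, Eventually.of_forall fun j => (hr j).2⟩
  have h2 := (tendsto_eLpNorm_extension_sub hf).comp h1
  exact (tendstoInMeasure_of_tendsto_eLpNorm two_ne_zero
    (fun j => (continuous_circle (fun w hw => hasSum_extension f hw) (hr j)).aestronglyMeasurable)
    hf.1.1 h2).exists_seq_tendsto_ae

/-- Three functions of class `H²` have simultaneous radial limits along some sequence of radii. -/
theorem exists_seq_tendsto_extension (f : Fin 3 → Torus → ℂ) (hf : ∀ i, MemHardy (f i) 2) :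
    ∃ r : ℕ → ℝ, (∀ j, r j ∈ Set.Ico (0 : ℝ) 1) ∧
      ∀ᵐ t ∂m, ∀ i, Tendsto (fun j => extension (f i) (r j * zeta t)) atTop (𝓝 (f i t)) := by
  let r : ℕ → ℝ := fun j => 1 - 1 / ((j : ℝ) + 1)
  have hr : ∀ j, r j ∈ Set.Ico (0 : ℝ) 1 := fun j => by
    have h1 : (0 : ℝ) < 1 / ((j : ℝ) + 1) := Nat.one_div_pos_of_nat
    have h2 : 1 / ((j : ℝ) + 1) ≤ 1 := by
      rw [div_le_one (by positivity)]; linarith [(Nat.cast_nonneg j : (0 : ℝ) ≤ j)]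
    exact ⟨by simp only [r]; linarith, by simp only [r]; linarith⟩
  have hr1 : Tendsto r atTop (𝓝 1) := by
    simpa [r] using (tendsto_one_div_add_atTop_nhds_zero_nat (𝕜 := ℝ)).const_sub 1
  -- Successive subsequences: each passage keeps the limits already obtained.
  obtain ⟨n₁, hn₁, h₁⟩ := exists_subseq_tendsto_extension (hf 0) hr hr1
  obtain ⟨n₂, hn₂, h₂⟩ := exists_subseq_tendsto_extension (hf 1) (fun j => hr (n₁ j))
    (hr1.comp hn₁.tendsto_atTop)
  obtain ⟨n₃, hn₃, h₃⟩ := exists_subseq_tendsto_extension (hf 2) (fun j => hr (n₁ (n₂ j)))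
    (hr1.comp (hn₁.tendsto_atTop.comp hn₂.tendsto_atTop))
  refine ⟨fun j => r (n₁ (n₂ (n₃ j))), fun j => hr _, ?_⟩
  filter_upwards [h₁, h₂, h₃] with t ha hb hc i
  fin_cases i
  · exact ha.comp (hn₂.tendsto_atTop.comp hn₃.tendsto_atTop)
  · exact hb.comp hn₃.tendsto_atTop
  · exact hc

theorem mul_ae_eq_of_extension_mul_eq {f g h : Torus → ℂ} (hf : MemHardy f 2) (hg : MemHardy g 2)
    (hh : MemHardy h 2)
    (heq : ∀ w ∈ Metric.ball (0 : ℂ) 1, extension f w * extension g w = extension h w) :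
    ∀ᵐ t ∂m, f t * g t = h t := by
  obtain ⟨r, hr, hlim⟩ := exists_seq_tendsto_extension ![f, g, h]
    (by intro i; fin_cases i <;> assumption)
  filter_upwards [hlim] with t ht
  have h1 := (ht 0).mul (ht 1)
  have h2 := ht 2
  simp only [Matrix.cons_val] at h1 h2
  refine tendsto_nhds_unique h1 (h2.congr fun j => ?_)
  rw [heq _ (mul_zeta_mem_ball (hr j) t)]

theorem norm_ae_eq_rpow_of_extension {h k : Torus → ℂ} (hh : MemHardy h 2) (hk : MemHardy k 2)
    {α : ℝ} (hα : 0 ≤ α)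
    (heq : ∀ w ∈ Metric.ball (0 : ℂ) 1, ‖extension k w‖ = ‖extension h w‖ ^ α) :
    ∀ᵐ t ∂m, ‖k t‖ = ‖h t‖ ^ α := by
  -- Only two functions are involved; the second k fills the third slot.
  obtain ⟨r, hr, hlim⟩ := exists_seq_tendsto_extension ![h, k, k]
    (by intro i; fin_cases i <;> assumption)
  filter_upwards [hlim] with t ht
  have h1 := ((Real.continuous_rpow_const hα).tendsto _).comp (ht 0).norm
  have h2 := (ht 1).norm
  simp only [Matrix.cons_val] at h1 h2
  refine tendsto_nhds_unique h2 (h1.congr fun j => ?_)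
  rw [Function.comp_apply, heq _ (mul_zeta_mem_ball (hr j) t)]

/-! ### Analytic powers with exponent between 0 and 1. -/

lemma norm_exp_mul {α : ℝ} {z x : ℂ} (hx : Complex.exp z = x) :
    ‖Complex.exp ((α : ℂ) * z)‖ = ‖x‖ ^ α := by
  rw [← hx, Complex.norm_exp, Complex.norm_exp, Complex.re_ofReal_mul, mul_comm, Real.exp_mul]

lemma rpow_le_one_add {x α : ℝ} (hx : 0 ≤ x) (hα0 : 0 ≤ α) (hα1 : α ≤ 1) : x ^ α ≤ 1 + x := by
  rcases le_total x 1 with h | h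
  · exact (Real.rpow_le_one hx h hα0).trans (by linarith)
  · have := Real.rpow_le_rpow_of_exponent_le h hα1
    rw [Real.rpow_one] at this
    linarith

theorem exists_memHardy_two_of_summable {c : ℕ → ℂ} (hc : Summable fun n => ‖c n‖ ^ 2) :
    ∃ k : Torus → ℂ, MemHardy k 2 ∧ ∀ n : ℕ, fourierCoeff k (n : ℤ) = c n := by
  have hs : Summable fun n : ℤ => ‖if 0 ≤ n then c n.toNat else 0‖ ^ 2 := by
    refine (Function.Injective.summable_iff (g := fun n : ℕ => (n : ℤ)) Nat.cast_injective ?_).1 ?_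
    · intro k hk
      rw [if_neg]
      · simp
      · intro h0
        exact hk ⟨k.toNat, by simp; omega⟩
    · simpa [Function.comp_def] using hc
  obtain ⟨k, hk, hkc⟩ := exists_memLp_two_fourierCoeff hs
  exact ⟨k, ⟨hk, fun n hn => by rw [hkc, if_neg (by omega)]⟩, fun n => by simp [hkc]⟩

/-- Powers with exponent in `[0, 1]` of a function of class `H²` are of class `H²`. -/
theorem exists_memHardy_two_power {h : Torus → ℂ} (hh : MemHardy h 2) {α : ℝ} (hα0 : 0 ≤ α)
    (hα1 : α ≤ 1) {L : ℂ → ℂ} (hL : DifferentiableOn ℂ L (Metric.ball 0 1))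
    (hLh : ∀ w ∈ Metric.ball (0 : ℂ) 1, Complex.exp (L w) = extension h w) :
    ∃ k : Torus → ℂ, MemHardy k 2 ∧
      ∀ w ∈ Metric.ball (0 : ℂ) 1, extension k w = Complex.exp ((α : ℂ) * L w) := by
  have hd : DifferentiableOn ℂ (fun w => Complex.exp ((α : ℂ) * L w)) (Metric.ball 0 1) :=
    (hL.const_mul _).cexp
  let c : ℕ → ℂ := fun n =>
    (n.factorial : ℂ)⁻¹ * iteratedDeriv n (fun w => Complex.exp ((α : ℂ) * L w)) 0
  have hK : ∀ w ∈ Metric.ball (0 : ℂ) 1,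
      HasSum (fun n => c n * w ^ n) (Complex.exp ((α : ℂ) * L w)) := fun w hw => by
    refine (Complex.hasSum_taylorSeries_on_ball hd hw).congr_fun fun n => ?_
    simp only [c, sub_zero, smul_eq_mul]; ring
  have hc := summable_sq_norm_of_norm_le_one_add hK (fun w hw => hasSum_extension h hw)
    (summable_sq_norm_fourierCoeff_nat hh.1) fun w hw => by
      rw [norm_exp_mul (hLh w hw)]
      exact rpow_le_one_add (norm_nonneg _) hα0 hα1
  obtain ⟨k, hk, hkc⟩ := exists_memHardy_two_of_summable hc
  refine ⟨k, hk, fun w hw => ?_⟩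
  have := hasSum_extension k hw
  simp only [hkc] at this
  exact this.unique (hK w hw)

/-- The definition asks only for H¹. Domination by 1 + |h| in the disk makes the coefficients square
summable, and by uniqueness k agrees with the H² function having these coefficients. -/
theorem IsAnalyticPower.memHardy_two {h k : Torus → ℂ} {α : ℝ} (hh : MemHardy h 2) (hα0 : 0 ≤ α)
    (hα1 : α ≤ 1) (hk : IsAnalyticPower h α k) : MemHardy k 2 := by
  obtain ⟨hk1, L, -, hL⟩ := hk
  have hc := summable_sq_norm_of_norm_le_one_add (fun w hw => hasSum_extension k hw)
    (fun w hw => hasSum_extension h hw)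
    (summable_sq_norm_fourierCoeff_nat hh.1) fun w hw => by
      rw [(hL w hw).2, norm_exp_mul (hL w hw).1]
      exact rpow_le_one_add (norm_nonneg _) hα0 hα1
  obtain ⟨k', hk', hkc⟩ := exists_memHardy_two_of_summable hc
  have hae : k' =ᵐ[m] k := by
    refine ae_eq_of_fourierCoeff_eq (integrable_of_memLp_two hk'.1)
      (memLp_one_iff_integrable.1 hk1.1) fun n => ?_
    rcases lt_or_ge n 0 with hn | hn
    · rw [hk'.2 n hn, hk1.2 n hn]
    · rw [← Int.toNat_of_nonneg hn, hkc]
  exact ⟨(memLp_congr_ae hae).1 hk'.1, hk1.2⟩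

theorem IsAnalyticPower.norm_ae_eq {h k : Torus → ℂ} {α : ℝ} (hh : MemHardy h 2) (hα0 : 0 ≤ α)
    (hα1 : α ≤ 1) (hk : IsAnalyticPower h α k) : ∀ᵐ t ∂m, ‖k t‖ = ‖h t‖ ^ α := by
  have hk2 := hk.memHardy_two hh hα0 hα1
  obtain ⟨-, L, -, hL⟩ := hk
  exact norm_ae_eq_rpow_of_extension hh hk2 hα0 fun w hw => by
    rw [(hL w hw).2, norm_exp_mul (hL w hw).1]

/-- A power of an outer function together with the complementary power. -/
theorem IsOuter.exists_isAnalyticPower {h : Torus → ℂ} (hh : IsOuter h) {α : ℝ} (hα0 : 0 ≤ α)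
    (hα1 : α ≤ 1) :
    ∃ k k' : Torus → ℂ, IsAnalyticPower h α k ∧ MemHardy k 2 ∧ MemHardy k' 2 ∧
      ∀ᵐ t ∂m, k t * k' t = h t := by
  obtain ⟨L, hL, hLh⟩ := exists_differentiableOn_exp_eq (differentiableOn_extension h)
    fun w hw => hh.extension_ne_zero hw
  obtain ⟨k, hk, hkL⟩ := exists_memHardy_two_power hh.1 hα0 hα1 hL hLh
  -- The same branch L is used for the exponent 1 - α, so the two powers multiply to exactly h, with
  -- no unimodular constant.
  obtain ⟨k', hk', hkL'⟩ := exists_memHardy_two_power hh.1 (sub_nonneg.2 hα1) (by linarith) hL hLh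
  refine ⟨k, k', ⟨hk.one_of_two, L, hL, fun w hw => ⟨hLh w hw, hkL w hw⟩⟩, hk, hk',
    mul_ae_eq_of_extension_mul_eq hk hk' hh.1 fun w hw => ?_⟩
  rw [hkL w hw, hkL' w hw, ← Complex.exp_add, ← hLh w hw]
  congr 1; push_cast; ring

/-! ### The dual function and pointwise inequalities. -/

/-- The dual function `|φ| ^ (P - 2) * conj φ` of a function of class `L^P`. -/
noncomputable def dualFunction (P : ℝ) (φ : Torus → ℂ) (t : Torus) : ℂ :=
  ((‖φ t‖ ^ (P - 2) : ℝ) : ℂ) * conj (φ t)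

lemma aestronglyMeasurable_norm_rpow {φ : Torus → ℂ} (hφ : AEStronglyMeasurable φ m) (x : ℝ) :
    AEStronglyMeasurable (fun t => ((‖φ t‖ ^ x : ℝ) : ℂ)) m :=
  Complex.continuous_ofReal.comp_aestronglyMeasurable
    (hφ.norm.aemeasurable.pow_const x).aestronglyMeasurable

lemma aestronglyMeasurable_conj {φ : Torus → ℂ} (hφ : AEStronglyMeasurable φ m) :
    AEStronglyMeasurable (fun t => conj (φ t)) m :=
  Complex.continuous_conj.comp_aestronglyMeasurable hφ

lemma aestronglyMeasurable_dualFunction {φ : Torus → ℂ} (hφ : AEStronglyMeasurable φ m) (P : ℝ) :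
    AEStronglyMeasurable (dualFunction P φ) m :=
  (aestronglyMeasurable_norm_rpow hφ _).mul (aestronglyMeasurable_conj hφ)

lemma norm_dualFunction (P : ℝ) (φ : Torus → ℂ) (t : Torus) :
    ‖dualFunction P φ t‖ = ‖φ t‖ ^ (P - 2) * ‖φ t‖ := by
  rw [dualFunction, norm_mul, Complex.norm_real, RCLike.norm_conj,
    Real.norm_of_nonneg (Real.rpow_nonneg (norm_nonneg _) _)]

/-- Young's inequality for x^(P-1) and y with exponents P/(P-1) and P. It gives both the
integrability of the dual pairing and the tangent line inequality. -/
lemma rpow_sub_two_mul_mul_le {P x y : ℝ} (hP : 2 ≤ P) (hx : 0 ≤ x) (hy : 0 ≤ y) :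
    x ^ (P - 2) * x * y ≤ (1 - P⁻¹) * x ^ P + P⁻¹ * y ^ P := by
  have hP0 : 0 < P := by linarith
  have hP1 : 0 < P - 1 := by linarith
  have hconj : (P / (P - 1)).HolderConjugate P := by
    rw [Real.holderConjugate_iff]
    refine ⟨by rw [lt_div_iff₀ hP1]; linarith, ?_⟩
    field_simp; ring
  have h1 : x ^ (P - 2) * x = x ^ (P - 1) := by
    rcases hx.eq_or_lt with h | h
    · rw [← h, Real.zero_rpow hP1.ne', mul_zero]
    · rw [← Real.rpow_add_one h.ne']; congr 1; ring
  have h2 := Real.young_inequality_of_nonneg (Real.rpow_nonneg hx (P - 1)) hy hconj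
  rw [← Real.rpow_mul hx, mul_div_cancel₀ _ hP1.ne'] at h2
  rw [h1]
  refine h2.trans (le_of_eq ?_)
  field_simp

lemma rpow_sub_two_mul_sq {P x : ℝ} (hP : 2 ≤ P) (hx : 0 ≤ x) : x ^ (P - 2) * x ^ 2 = x ^ P := by
  rcases hx.eq_or_lt with h | h
  · rw [← h, Real.zero_rpow (by linarith : P ≠ 0)]; simp
  · rw [← Real.rpow_two, ← Real.rpow_add h]; congr 1; ring

/-- The tangent line inequality for `|·| ^ P`. -/
lemma norm_rpow_le_add_re {P : ℝ} (hP : 2 ≤ P) (a b : ℂ) :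
    P⁻¹ * ‖a‖ ^ P ≤ P⁻¹ * ‖a - b‖ ^ P + (((‖a‖ ^ (P - 2) : ℝ) : ℂ) * conj a * b).re := by
  have hn : 0 ≤ ‖a‖ ^ (P - 2) := Real.rpow_nonneg (norm_nonneg _) _
  have h1 : ‖a‖ ^ P = (((‖a‖ ^ (P - 2) : ℝ) : ℂ) * conj a * a).re := by
    rw [mul_assoc, Complex.conj_mul', ← Complex.ofReal_pow, ← Complex.ofReal_mul, Complex.ofReal_re,
      rpow_sub_two_mul_sq hP (norm_nonneg _)]
  have h2 : (((‖a‖ ^ (P - 2) : ℝ) : ℂ) * conj a * a).re =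
      (((‖a‖ ^ (P - 2) : ℝ) : ℂ) * conj a * (a - b)).re +
        (((‖a‖ ^ (P - 2) : ℝ) : ℂ) * conj a * b).re := by
    rw [← Complex.add_re]; congr 1; ring
  have h3 : (((‖a‖ ^ (P - 2) : ℝ) : ℂ) * conj a * (a - b)).re ≤ ‖a‖ ^ (P - 2) * ‖a‖ * ‖a - b‖ := by
    refine (Complex.re_le_norm _).trans (le_of_eq ?_)
    rw [norm_mul, norm_mul, Complex.norm_real, RCLike.norm_conj, Real.norm_of_nonneg hn]
  have h4 := rpow_sub_two_mul_mul_le hP (norm_nonneg a) (norm_nonneg (a - b))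
  linarith

/-! ### Bad approximability as annihilation of H^p by the dual function. -/

section Duality

variable {p : ℝ≥0∞} {φ : Torus → ℂ}

lemma two_le_toReal (hp : 2 ≤ p) (hp' : p ≠ ∞) : 2 ≤ p.toReal := by
  simpa using ENNReal.toReal_mono hp' hp

lemma integrable_dualFunction_mul (hp : 2 ≤ p) (hp' : p ≠ ∞) (hφ : MemLp φ p m) {ψ : Torus → ℂ}
    (hψ : MemLp ψ p m) : Integrable (fun t => dualFunction p.toReal φ t * ψ t) m := by
  have hp0 : p ≠ 0 := fun h => by simp [h] at hp
  refine Integrable.mono' (((hφ.integrable_norm_rpow hp0 hp').const_mul (1 - p.toReal⁻¹)).add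
    ((hψ.integrable_norm_rpow hp0 hp').const_mul p.toReal⁻¹))
    ((aestronglyMeasurable_dualFunction hφ.1 _).mul hψ.1) (Eventually.of_forall fun t => ?_)
  rw [norm_mul, norm_dualFunction]
  exact rpow_sub_two_mul_mul_le (two_le_toReal hp hp') (norm_nonneg _) (norm_nonneg _)

lemma integrable_dualFunction (hp : 2 ≤ p) (hp' : p ≠ ∞) (hφ : MemLp φ p m) :
    Integrable (dualFunction p.toReal φ) m := by
  simpa using integrable_dualFunction_mul hp hp' hφ (memLp_const (1 : ℂ))

lemma eLpNorm_le_iff_integral (hp : 2 ≤ p) (hp' : p ≠ ∞) (hφ : MemLp φ p m) {ψ : Torus → ℂ}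
    (hψ : MemLp ψ p m) :
    eLpNorm φ p m ≤ eLpNorm ψ p m ↔ ∫ t, ‖φ t‖ ^ p.toReal ∂m ≤ ∫ t, ‖ψ t‖ ^ p.toReal ∂m := by
  have hp0 : p ≠ 0 := fun h => by simp [h] at hp
  have hP : 0 < p.toReal⁻¹ := inv_pos.2 (by linarith [two_le_toReal hp hp'])
  have hnn : ∀ f : Torus → ℂ, 0 ≤ ∫ t, ‖f t‖ ^ p.toReal ∂m := fun f =>
    integral_nonneg fun t => Real.rpow_nonneg (norm_nonneg _) _
  rw [hφ.eLpNorm_eq_integral_rpow_norm hp0 hp', hψ.eLpNorm_eq_integral_rpow_norm hp0 hp',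
    ENNReal.ofReal_le_ofReal_iff (Real.rpow_nonneg (hnn ψ) _),
    Real.rpow_le_rpow_iff (hnn φ) (hnn ψ) hP]

/-- Integrating the tangent line inequality at φ leaves no linear term. -/
theorem isBadlyApproximable_of_integral_eq_zero (hp : 2 ≤ p) (hp' : p ≠ ∞) (hφ : MemLp φ p m)
    (h : ∀ ψ, MemHardy ψ p → ∫ t, dualFunction p.toReal φ t * ψ t ∂m = 0) :
    IsBadlyApproximable p φ := by
  refine ⟨hφ, fun ψ hψ => ?_⟩
  have hp0 : p ≠ 0 := fun h => by simp [h] at hp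
  have hP : 0 < p.toReal⁻¹ := inv_pos.2 (by linarith [two_le_toReal hp hp'])
  have hd : MemLp (fun t => φ t - ψ t) p m := hφ.sub hψ.1
  rw [eLpNorm_le_iff_integral hp hp' hφ hd]
  have hi := integrable_dualFunction_mul hp hp' hφ hψ.1
  have h1 := integral_mono ((hφ.integrable_norm_rpow hp0 hp').const_mul p.toReal⁻¹)
    (((hd.integrable_norm_rpow hp0 hp').const_mul p.toReal⁻¹).add hi.re)
    fun t => norm_rpow_le_add_re (two_le_toReal hp hp') (φ t) (ψ t)
  rw [integral_add' ((hd.integrable_norm_rpow hp0 hp').const_mul p.toReal⁻¹) hi.re,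
    integral_const_mul, integral_const_mul, integral_re hi, h ψ hψ, map_zero, add_zero] at h1
  exact (mul_le_mul_iff_right₀ hP).1 h1

/-- A minimum of the `L^P` norm in the direction `b` is a critical point. -/
lemma re_integral_dualFunction_mul_eq_zero (hp : 2 ≤ p) (hp' : p ≠ ∞) (hφ : MemLp φ p m)
    {b : Torus → ℂ} (hb : MemLp b p m) (hb1 : ∀ t, ‖b t‖ ≤ 1)
    (hmin : ∀ s : ℝ, eLpNorm φ p m ≤ eLpNorm (fun t => φ t - s * b t) p m) :
    (∫ t, dualFunction p.toReal φ t * b t ∂m).re = 0 := by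
  have hp0 : p ≠ 0 := fun h => by simp [h] at hp
  have hP := two_le_toReal hp hp'
  set P := p.toReal with hPdef
  have hmem : ∀ s : ℝ, MemLp (fun t => φ t - s * b t) p m := fun s => hφ.sub (hb.const_mul _)
  let F : ℝ → Torus → ℝ := fun s t => ‖φ t - s * b t‖ ^ P
  let F' : ℝ → Torus → ℝ := fun s t =>
    (P * ‖φ t - s * b t‖ ^ (P - 2)) * inner ℝ (φ t - s * b t) (-b t)
  have hder : ∀ t, ∀ s : ℝ, HasDerivAt (fun s => F s t) (F' s t) s := by
    intro t s
    have h1 : HasDerivAt (fun s : ℝ => φ t - (s : ℂ) * b t) (-b t) s := by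
      have := ((Complex.ofRealCLM.hasDerivAt (x := s)).mul_const (b t)).const_sub (φ t)
      simpa using this
    have h2 := (hasFDerivAt_norm_rpow (φ t - (s : ℂ) * b t) (p := P) (by linarith)).comp_hasDerivAt s h1
    exact h2
  -- A dominating function uniform in |s| < 1; the bound on b and the summand 1, which allows
  -- raising the exponent to P, serve only this purpose.
  have hbound : ∀ t, ∀ s ∈ Metric.ball (0 : ℝ) 1, ‖F' s t‖ ≤ P * ‖(‖φ t‖ + 1 : ℝ)‖ ^ P := by
    intro t s hs
    set y := φ t - s * b t
    have hy : ‖y‖ ≤ ‖φ t‖ + 1 := by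
      refine (norm_sub_le _ _).trans ?_
      rw [norm_mul, Complex.norm_real]
      have := mul_le_mul (mem_ball_zero_iff.1 hs).le (hb1 t) (norm_nonneg _) zero_le_one
      linarith
    have hx1 : 1 ≤ ‖φ t‖ + 1 := by linarith [norm_nonneg (φ t)]
    have hin : ‖inner ℝ y (-b t)‖ ≤ ‖φ t‖ + 1 := by
      refine (norm_inner_le_norm _ _).trans ?_
      rw [norm_neg]
      exact (mul_le_of_le_one_right (norm_nonneg _) (hb1 t)).trans hy
    rw [Real.norm_of_nonneg (by positivity : (0 : ℝ) ≤ ‖φ t‖ + 1)]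
    simp only [F', norm_mul]
    rw [Real.norm_of_nonneg (by linarith : 0 ≤ P), Real.norm_of_nonneg (by positivity), mul_assoc]
    refine mul_le_mul_of_nonneg_left ?_ (by linarith)
    calc _ ≤ (‖φ t‖ + 1) ^ (P - 2) * (‖φ t‖ + 1) := by
          refine mul_le_mul (Real.rpow_le_rpow (norm_nonneg _) hy (by linarith)) hin
            (norm_nonneg _) (by positivity)
      _ ≤ (‖φ t‖ + 1) ^ (P - 2) * (‖φ t‖ + 1) ^ 2 :=
          mul_le_mul_of_nonneg_left (by nlinarith) (by positivity)
      _ = _ := rpow_sub_two_mul_sq hP (by positivity)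
  have hF0 : F' 0 = fun t => -P * (dualFunction P φ t * b t).re := by
    ext t
    simp only [F', Complex.ofReal_zero, zero_mul, sub_zero, Complex.inner, dualFunction, mul_assoc,
      Complex.re_ofReal_mul]
    rw [neg_mul, Complex.neg_re, mul_comm (b t)]; ring
  have hi := integrable_dualFunction_mul hp hp' hφ hb
  have hbi : Integrable (fun t => P * ‖(‖φ t‖ + 1 : ℝ)‖ ^ P) m :=
    ((hφ.norm.add (memLp_const (1 : ℝ))).integrable_norm_rpow hp0 hp').const_mul P
  have hD := (hasDerivAt_integral_of_dominated_loc_of_deriv_le (μ := m) (F := F) (F' := F')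
    (Metric.ball_mem_nhds (0 : ℝ) one_pos)
    (Eventually.of_forall fun s => ((hmem s).integrable_norm_rpow hp0 hp').1)
    ((hmem 0).integrable_norm_rpow hp0 hp')
    (by rw [hF0]; exact (hi.re.const_mul (-P)).1)
    (Eventually.of_forall hbound) hbi (Eventually.of_forall fun t s _ => hder t s)).2
  have hloc : IsLocalMin (fun s => ∫ t, F s t ∂m) 0 := by
    refine Eventually.of_forall fun s => ?_
    have := (eLpNorm_le_iff_integral hp hp' hφ (hmem s)).1 (hmin s)
    simpa [F] using this
  have h0 := hloc.hasDerivAt_eq_zero hD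
  rw [hF0, integral_const_mul] at h0
  have h1 := integral_re hi
  have h2 := (mul_eq_zero.1 h0).resolve_left (by linarith)
  exact h1.symm.trans h2

/-- For n ≤ 0 the monomial z^(-n) is a bounded function in H^p, so criticality applies in its
direction; the multiples by 1 and i capture the real and imaginary parts. -/
theorem IsBadlyApproximable.fourierCoeff_dualFunction_eq_zero (hp : 2 ≤ p) (hp' : p ≠ ∞)
    (h : IsBadlyApproximable p φ) {n : ℤ} (hn : n ≤ 0) :
    fourierCoeff (dualFunction p.toReal φ) n = 0 := by
  have key : ∀ c : ℂ, ‖c‖ = 1 →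
      (c * fourierCoeff (dualFunction p.toReal φ) n).re = 0 := by
    intro c hc
    have hbase : MemHardy (fun t => c * fourier (-n) t) p := by
      refine ⟨(memLp_of_continuous (map_continuous _) p).const_mul c, fun k hk => ?_⟩
      rw [fourierCoeff.const_mul, fourierCoeff_fourier, Pi.single_eq_of_ne (by omega), mul_zero]
    have h1 := re_integral_dualFunction_mul_eq_zero hp hp' h.1 hbase.1
      (fun t => by rw [norm_mul, hc, norm_fourier_apply, one_mul]) fun s => by
        refine h.2 _ ⟨hbase.1.const_mul _, fun k hk => ?_⟩
        rw [fourierCoeff.const_mul, hbase.2 k hk, mul_zero]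
    rw [← h1, fourierCoeff, ← integral_const_mul]
    congr 1
    refine integral_congr_ae (Eventually.of_forall fun t => ?_)
    simp only [smul_eq_mul]; ring
  refine Complex.ext ?_ ?_
  · simpa using key 1 norm_one
  · simpa using key Complex.I Complex.norm_I

end Duality

/-! ### The factorization, in both directions. -/

section Factorization

variable {p q : ℝ≥0∞} {φ : Torus → ℂ}

lemma toReal_two_div (hp : 2 ≤ p) (hp' : p ≠ ∞) (hpq : p⁻¹ + q⁻¹ = 2⁻¹) :
    (2 / q).toReal = (p.toReal - 2) / p.toReal := by
  have hp0 : p ≠ 0 := fun h => by simp [h] at hp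
  have hP := two_le_toReal hp hp'
  have hq : q⁻¹ ≠ ∞ := fun h => by simp [h, eq_comm (a := ∞)] at hpq
  have h := congrArg ENNReal.toReal hpq
  rw [ENNReal.toReal_add (ENNReal.inv_ne_top.2 hp0) hq, ENNReal.toReal_inv, ENNReal.toReal_inv,
    ENNReal.toReal_inv, ENNReal.toReal_ofNat] at h
  rw [div_eq_mul_inv, ENNReal.toReal_mul, ENNReal.toReal_ofNat, ENNReal.toReal_inv,
    ← sub_eq_iff_eq_add'.2 h.symm]
  field_simp

/-- Here |φ| = |h|^(1-α) and (1-α)(P-2) = 2α, so |φ|^(P-2) = |k|² = k conj(k), and conj(k) cancels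
the denominator of conj(φ). -/
lemma dualFunction_ae_eq {P α : ℝ} (hP : 2 ≤ P) (hα : α = (P - 2) / P) {θ h k : Torus → ℂ}
    (hθ : ∀ᵐ t ∂m, ‖θ t‖ = 1) (hh0 : ∀ᵐ t ∂m, h t ≠ 0) (hk : ∀ᵐ t ∂m, ‖k t‖ = ‖h t‖ ^ α)
    (hφ : ∀ᵐ t ∂m, φ t = conj (zeta t) * conj (θ t) * (conj (h t) / k t)) :
    ∀ᵐ t ∂m, dualFunction P φ t = zeta t * (h t * (θ t * k t)) := by
  filter_upwards [hθ, hh0, hk, hφ] with t h1 h2 h3 h4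
  have hpos : 0 < ‖h t‖ := norm_pos_iff.2 h2
  have hkpos : 0 < ‖k t‖ := h3 ▸ Real.rpow_pos_of_pos hpos α
  have hn : ‖φ t‖ = ‖h t‖ ^ (1 - α) := by
    rw [h4, norm_mul, norm_mul, norm_div]
    simp only [RCLike.norm_conj, norm_zeta, h1, h3]
    rw [Real.rpow_sub hpos, Real.rpow_one]; ring
  have hn2 : ‖φ t‖ ^ (P - 2) = ‖k t‖ ^ 2 := by
    rw [hn, h3, ← Real.rpow_natCast, ← Real.rpow_mul hpos.le, ← Real.rpow_mul hpos.le]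
    congr 1
    rw [hα]; push_cast; field_simp; ring
  have hk0 : conj (k t) ≠ 0 := by
    rw [Ne, map_eq_zero]; exact norm_pos_iff.1 hkpos
  rw [dualFunction, hn2, Complex.ofReal_pow, ← Complex.mul_conj', h4]
  simp only [map_mul, map_div₀, Complex.conj_conj]
  field_simp

/-- The modulus condition puts k in L^q; Hölder's inequality with exponents q and p does the rest,
including q = ∞. -/
lemma memLp_two_mul_of_norm_eq_rpow (hpq : p⁻¹ + q⁻¹ = 2⁻¹) {h k ψ : Torus → ℂ} (hh : MemLp h 2 m)
    (hkm : AEStronglyMeasurable k m) (hk : ∀ᵐ t ∂m, ‖k t‖ = ‖h t‖ ^ (2 / q).toReal)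
    (hψ : MemLp ψ p m) : MemLp (fun t => k t * ψ t) 2 m := by
  have hq0 : q ≠ 0 := fun h => by simp [h, eq_comm (a := ∞)] at hpq
  have h1 := hh.norm_rpow_div (2 / q)
  have hq : 2 / (2 / q) = q := by
    rw [div_eq_mul_inv, div_eq_mul_inv, ENNReal.mul_inv (Or.inl two_ne_zero) (Or.inl ENNReal.ofNat_ne_top), inv_inv,
      ← mul_assoc, ENNReal.mul_inv_cancel two_ne_zero ENNReal.ofNat_ne_top, one_mul]
  rw [hq] at h1
  have hkq : MemLp k q m := by
    refine h1.of_le hkm ?_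
    filter_upwards [hk] with t ht
    rw [ht]; exact le_abs_self _
  have : ENNReal.HolderTriple q p 2 := ⟨by rw [add_comm, hpq]⟩
  exact hψ.mul hkq

lemma memLp_two_inner_mul {θ f : Torus → ℂ} (hθm : AEStronglyMeasurable θ m)
    (hθ : ∀ᵐ t ∂m, ‖θ t‖ = 1) (hf : MemLp f 2 m) : MemLp (fun t => θ t * f t) 2 m := by
  refine hf.of_le (hθm.mul hf.1) ?_
  filter_upwards [hθ] with t ht
  rw [norm_mul, ht, one_mul]

theorem isBadlyApproximable_of_factorization (hp : 2 ≤ p) (hp' : p ≠ ∞) (hpq : p⁻¹ + q⁻¹ = 2⁻¹)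
    (hφ : MemLp φ p m) {θ h k : Torus → ℂ} (hθ : IsInner θ) (hh : IsOuter h)
    (hk : IsAnalyticPower h (2 / q).toReal k)
    (hφe : φ =ᵐ[m] fun t => conj (zeta t) * conj (θ t) * (conj (h t) / k t)) :
    IsBadlyApproximable p φ := by
  have hP := two_le_toReal hp hp'
  have hα := toReal_two_div hp hp' hpq
  have hα0 : 0 ≤ (2 / q).toReal := ENNReal.toReal_nonneg
  have hα1 : (2 / q).toReal ≤ 1 := by
    rw [hα, div_le_one (by linarith)]; linarith
  have hk2 := hk.memHardy_two hh.1 hα0 hα1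
  have hkn := hk.norm_ae_eq hh.1 hα0 hα1
  have hθ2 : MemHardy θ 2 := ⟨hθ.1.1.mono_exponent le_top, hθ.1.2⟩
  refine isBadlyApproximable_of_integral_eq_zero hp hp' hφ fun ψ hψ => ?_
  have hψ2 : MemHardy ψ 2 := ⟨hψ.1.mono_exponent hp, hψ.2⟩
  have h1 : MemHardy (fun t => k t * ψ t) 2 :=
    ⟨memLp_two_mul_of_norm_eq_rpow hpq hh.1.1 hk2.1.1 hkn hψ.1,
      fun n hn => fourierCoeff_mul_eq_zero hk2 hψ2 hn⟩
  have h2 : MemHardy (fun t => θ t * (k t * ψ t)) 2 :=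
    ⟨memLp_two_inner_mul hθ.1.1.1 hθ.2 h1.1, fun n hn => fourierCoeff_mul_eq_zero hθ2 h1 hn⟩
  -- The extra factor z in the dual function turns its integral against ψ into the coefficient of
  -- index -1 of an analytic product.
  rw [← fourierCoeff_mul_eq_zero hh.1 h2 (n := -1) (by norm_num), ← integral_fourier_mul]
  refine integral_congr_ae ?_
  filter_upwards [dualFunction_ae_eq hP hα hθ.2 hh.ae_ne_zero hkn hφe] with t ht
  rw [ht, zeta_eq_fourier]; ring

/-- The outer function with modulus `|φ| ^ (P / 2)`. -/
theorem exists_isOuter_norm_eq_rpow (hp : 2 ≤ p) (hp' : p ≠ ∞) (hφ : MemLp φ p m)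
    (hφ0 : ¬ φ =ᵐ[m] 0) (hg : ∀ n : ℤ, n ≤ 0 → fourierCoeff (dualFunction p.toReal φ) n = 0) :
    ∃ h : Torus → ℂ, IsOuter h ∧ ∀ᵐ t ∂m, ‖h t‖ = ‖φ t‖ ^ (p.toReal / 2) := by
  have hp0 : p ≠ 0 := fun h => by simp [h] at hp
  have hP := two_le_toReal hp hp'
  have hint := integrable_dualFunction hp hp' hφ
  set P := p.toReal with hPdef
  set g := dualFunction P φ with hgdef
  have hex : ∃ n : ℕ, fourierCoeff g (n : ℤ) ≠ 0 := by
    by_contra! hc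
    refine hφ0 ?_
    have h0 : g =ᵐ[m] 0 := ae_eq_zero_of_fourierCoeff_eq_zero hint fun n => by
      rcases le_or_gt n 0 with hn | hn
      · exact hg n hn
      · rw [← Int.toNat_of_nonneg hn.le]; exact hc _
    filter_upwards [h0] with t ht
    by_contra hne
    have hpos : 0 < ‖φ t‖ := norm_pos_iff.2 hne
    have := norm_dualFunction P φ t
    rw [← hgdef, ht, Pi.zero_apply, norm_zero] at this
    exact (mul_pos (Real.rpow_pos_of_pos hpos _) hpos).ne this
  classical
  -- The first nonzero coefficient of g: z^(-N) g is orthogonal to higher shifts but has nonzero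
  -- mean. It is split below as wu with both factors in L².
  set N := Nat.find hex with hN
  have hlt : ∀ n : ℤ, n < N → fourierCoeff g n = 0 := fun n hn => by
    rcases le_or_gt n 0 with h0 | h0
    · exact hg n h0
    · rw [← Int.toNat_of_nonneg h0.le]
      exact not_not.1 (Nat.find_min hex (m := n.toNat) (by omega))
  let u : Torus → ℂ := fun t => ((‖φ t‖ ^ (P / 2) : ℝ) : ℂ)
  let w : Torus → ℂ := fun t => fourier (-(N : ℤ)) t * (((‖φ t‖ ^ (P / 2 - 2) : ℝ) : ℂ) * conj (φ t))
  have hun : ∀ t, ‖u t‖ = ‖φ t‖ ^ (P / 2) := fun t => by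
    simp only [u, Complex.norm_real]
    exact Real.norm_of_nonneg (Real.rpow_nonneg (norm_nonneg _) _)
  have hu : MemLp u 2 m := by
    rw [memLp_two_iff_integrable_sq_norm (aestronglyMeasurable_norm_rpow hφ.1 _)]
    refine (hφ.integrable_norm_rpow hp0 hp').congr (Eventually.of_forall fun t => ?_)
    simp only
    rw [show ‖((‖φ t‖ ^ (P / 2) : ℝ) : ℂ)‖ = ‖φ t‖ ^ (P / 2) from hun t, ← Real.rpow_natCast, ← Real.rpow_mul (norm_nonneg _)]
    congr 1; push_cast; ring
  have hwm : AEStronglyMeasurable w m := (aestronglyMeasurable_fourier _).mul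
    ((aestronglyMeasurable_norm_rpow hφ.1 _).mul (aestronglyMeasurable_conj hφ.1))
  have hw : MemLp w 2 m := by
    rw [memLp_two_iff_integrable_sq_norm hwm]
    refine Integrable.mono' ((integrable_const (1 : ℝ)).add (hφ.integrable_norm_rpow hp0 hp'))
      (hwm.norm.pow 2) (Eventually.of_forall fun t => ?_)
    simp only [w, norm_pow, norm_norm, norm_mul, norm_fourier_apply, one_mul, Complex.norm_real,
      RCLike.norm_conj, Pi.add_apply]
    rw [Real.norm_of_nonneg (Real.rpow_nonneg (norm_nonneg _) _)]
    rcases (norm_nonneg (φ t)).eq_or_lt with h | h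
    · rw [← h, Real.zero_rpow (by linarith : P ≠ 0)]; norm_num
    · have h1 : (‖φ t‖ ^ (P / 2 - 2) * ‖φ t‖) ^ 2 = ‖φ t‖ ^ (P - 2) := by
        rw [← Real.rpow_add_one h.ne', ← Real.rpow_natCast, ← Real.rpow_mul h.le]
        congr 1; push_cast; ring
      rw [h1]
      rcases le_total ‖φ t‖ 1 with h2 | h2
      · have := Real.rpow_le_one h.le h2 (by linarith : 0 ≤ P - 2)
        linarith [Real.rpow_nonneg h.le P]
      · have := Real.rpow_le_rpow_of_exponent_le h2 (by linarith : P - 2 ≤ P)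
        linarith
  have hwu : ∀ t, w t * u t = fourier (-(N : ℤ)) t * g t := by
    intro t
    simp only [w, u, g, dualFunction]
    rcases (norm_nonneg (φ t)).eq_or_lt with h | h
    · rw [norm_eq_zero.1 h.symm]; simp
    · have : P - 2 = (P / 2 - 2) + P / 2 := by ring
      rw [this, Real.rpow_add h]; push_cast; ring
  have hort : ∀ j : ℕ, ∫ t, w t * (zeta t ^ (j + 1) * u t) ∂m = 0 := fun j => by
    -- The integral is the coefficient of g of index N - (j + 1), which lies below N.
    rw [← hlt (N - (j + 1)) (by omega), fourierCoeff]
    refine integral_congr_ae (Eventually.of_forall fun t => ?_)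
    simp only [smul_eq_mul]
    rw [mul_left_comm, hwu, zeta_pow, ← mul_assoc, ← fourier_add]
    congr 3; push_cast; ring
  have hne : ∫ t, w t * u t ∂m ≠ 0 := by
    simp only [hwu]
    rw [integral_fourier_mul, neg_neg]
    exact Nat.find_spec hex
  obtain ⟨h, hh, hhn⟩ := exists_isOuter_norm_eq hu hw hort hne
  refine ⟨h, hh, ?_⟩
  filter_upwards [hhn] with t ht
  rw [ht, hun]

theorem IsBadlyApproximable.exists_factorization (hp : 2 ≤ p) (hp' : p ≠ ∞)
    (hpq : p⁻¹ + q⁻¹ = 2⁻¹) (hφ0 : ¬ φ =ᵐ[m] 0) (hbad : IsBadlyApproximable p φ) :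
    ∃ θ h k : Torus → ℂ, IsInner θ ∧ IsOuter h ∧ IsAnalyticPower h (2 / q).toReal k ∧
      φ =ᵐ[m] fun t => conj (zeta t) * conj (θ t) * (conj (h t) / k t) := by
  have hP := two_le_toReal hp hp'
  have hα := toReal_two_div hp hp' hpq
  have hα0 : 0 ≤ (2 / q).toReal := ENNReal.toReal_nonneg
  have hα1 : (2 / q).toReal ≤ 1 := by
    rw [hα, div_le_one (by linarith)]; linarith
  set α := (2 / q).toReal
  have hφ := hbad.1
  have hg : ∀ n : ℤ, n ≤ 0 → fourierCoeff (dualFunction p.toReal φ) n = 0 :=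
    fun n hn => hbad.fourierCoeff_dualFunction_eq_zero hp hp' hn
  obtain ⟨h, hh, hhn⟩ := exists_isOuter_norm_eq_rpow hp hp' hφ hφ0 hg
  set P := p.toReal with hPdef
  obtain ⟨k, k', hk, hk2, hk2', hkk'⟩ := hh.exists_isAnalyticPower hα0 hα1
  have hkn := hk.norm_ae_eq hh.1 hα0 hα1
  -- The required formula for φ, solved for θ.
  let θ : Torus → ℂ := fun t => conj (zeta t * φ t * k t) / h t
  have hθn : ∀ᵐ t ∂m, ‖θ t‖ = 1 := by
    filter_upwards [hhn, hkn, hh.ae_ne_zero] with t h1 h2 h3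
    have hpos : 0 < ‖h t‖ := norm_pos_iff.2 h3
    have hφn : ‖φ t‖ = ‖h t‖ ^ (2 / P) := by
      rw [h1, ← Real.rpow_mul (norm_nonneg _)]
      rw [show P / 2 * (2 / P) = 1 by field_simp, Real.rpow_one]
    simp only [θ, norm_div, RCLike.norm_conj, norm_mul, norm_zeta, one_mul]
    rw [hφn, h2, ← Real.rpow_add hpos, hα, show 2 / P + (P - 2) / P = 1 by field_simp; ring,
      Real.rpow_one, div_self hpos.ne']
  have hθm : AEStronglyMeasurable θ m :=
    (aestronglyMeasurable_conj
      ((continuous_zeta.aestronglyMeasurable.mul hφ.1).mul hk2.1.1)).div₀ hh.1.1.1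
  have hθ : MemLp θ ∞ m := memLp_top_of_bound hθm 1 (hθn.mono fun t ht => ht.le)
  have hφe : φ =ᵐ[m] fun t => conj (zeta t) * conj (θ t) * (conj (h t) / k t) := by
    filter_upwards [hkn, hh.ae_ne_zero] with t h1 h2
    have hk0 : k t ≠ 0 := by
      rw [← norm_pos_iff, h1]; exact Real.rpow_pos_of_pos (norm_pos_iff.2 h2) _
    have hh0 : conj (h t) ≠ 0 := by rwa [Ne, map_eq_zero]
    have hz : conj (zeta t) * zeta t = 1 := by rw [Complex.conj_mul', norm_zeta]; simp
    simp only [θ, map_div₀, Complex.conj_conj]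
    field_simp
    rw [mul_assoc, hz, mul_one]
  have hdual := dualFunction_ae_eq hP hα hθn hh.ae_ne_zero hkn hφe
  have hθk : MemLp (fun t => θ t * k t) 2 m := memLp_two_inner_mul hθm hθn hk2.1
  have hθk' : MemHardy (fun t => θ t * k t) 2 := by
    refine ⟨hθk, fun n hn => hh.fourierCoeff_eq_zero_of_mul hθk (fun n hn => ?_) hn⟩
    -- Since g = z h θ k, the n-th coefficient of θkh is the coefficient of g at n + 1, and n < 0
    -- gives n + 1 ≤ 0.
    rw [← hg (n + 1) (by omega), ← sub_neg_eq_add, ← fourierCoeff_fourier_mul]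
    refine congrFun (fourierCoeff_congr_ae ?_) n
    filter_upwards [hdual] with t ht
    rw [ht, zeta_eq_fourier, ← mul_assoc, ← fourier_add]
    simp [mul_comm]
  have hθH : ∀ n : ℤ, n < 0 → fourierCoeff θ n = 0 := fun n hn => by
    refine hh.fourierCoeff_eq_zero_of_mul (hθ.mono_exponent le_top) (fun n hn => ?_) hn
    -- θh = (θk)k' is a product of two H² functions, so h can be cancelled a second time.
    rw [← fourierCoeff_mul_eq_zero hθk' hk2' hn]
    refine congrFun (fourierCoeff_congr_ae ?_) n
    filter_upwards [hkk'] with t ht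
    rw [mul_assoc, ht]
  exact ⟨θ, h, k, ⟨⟨hθ, hθH⟩, hθn⟩, hh, hk, hφe⟩

end Factorization

end HardyApprox

theorem theorem2p1 (p q : ℝ≥0∞) (hp : 2 ≤ p) (hp' : p ≠ ∞) (hpq : p⁻¹ + q⁻¹ = 2⁻¹)
    (φ : HardyApprox.Torus → ℂ) (hφ : MemLp φ p HardyApprox.m)
    (hφ0 : ¬ φ =ᵐ[HardyApprox.m] 0) :
    (2 / q).toReal = (p.toReal - 2) / p.toReal ∧
    (HardyApprox.IsBadlyApproximable p φ ↔
      ∃ θ h k : HardyApprox.Torus → ℂ,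
        HardyApprox.IsInner θ ∧ HardyApprox.IsOuter h ∧
        HardyApprox.IsAnalyticPower h (2 / q).toReal k ∧
        φ =ᵐ[HardyApprox.m]
          fun t => conj (HardyApprox.zeta t) * conj (θ t) * (conj (h t) / k t)) :=
  ⟨HardyApprox.toReal_two_div hp hp' hpq,
    fun h => h.exists_factorization hp hp' hpq hφ0,
    fun ⟨_, _, _, hθ, hh, hk, hφe⟩ =>
      HardyApprox.isBadlyApproximable_of_factorization hp hp' hpq hφ hθ hh hk hφe⟩
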